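/- Let $\mathbb T=\mathbb R/2\pi\mathbb Z$, $V(x)=\cos(2x)$ and $F(x)=-\cos x$. For $\sigma>0$ consider the stationary McKean–Vlasov equation $$\sigma\,\partial_{xx}\rho(x)+\partial_x\Big[\Big(-2\sin(2x)+\int_{\mathbb T}\sin(x-y)\rho(y)\,dy\Big)\rho(x)\Big]=0,\qquad x\in\mathbb T.\qquad(\ast)$$ A solution of $(\ast)$ is a probability density $\rho\in H^1(\mathbb T;\mathbb R)$ that satisfies the equation in the weak sense, i.e. $\int_{\mathbb T}\big(\sigma\rho'+(V'+F'*\rho)\rho\big)\varphi'\,dx=0$ for all $\varphi\in C^\infty(\mathbb T)$; solutions that agree almost everywhere are identified. Say that a continuous density $\rho$ is centred around $c\in\mathbb T$ if $\rho(c+x)=\rho(c-x)$ for all $x$, $\rho(x)<\rho(c)$ for all $x\neq c$, and $\int_{\mathbb T}e^{ix}\rho(x)\,dx$ is a positive multiple of $e^{ic}$. For $z\in\mathbb R$ let $$I_n(z)=\int_0^{2\pi}\cos(2nx)\,e^{z\cos(2x)}\,dx,\qquad r_0(z)=\frac{I_1(z)}{I_0(z)},\qquad f_c(\sigma)=\frac1\sigma-2+\frac1\sigma\,r_0\Big(\frac1\sigma\Big)\quad(\sigma>0).$$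 1. For every $\sigma>0$ the density $\rho_{0,0}(x)=\frac1{Z_\sigma}e^{-\cos(2x)/\sigma}$, with $Z_\sigma=\int_{\mathbb T}e^{-\cos(2x)/\sigma}\,dx$, is a solution of $(\ast)$. 2. The function $f_c$ has exactly one zero $\sigma_c$ in $(0,\infty)$, and $|\sigma_c-0.7709|\le 5\cdot10^{-5}$. 3. If $\sigma>\sigma_c$, then $\rho_{0,0}$ is the only solution of $(\ast)$. 4. There is $\sigma_0>0$ such that, whenever $0<\sigma<\sigma_0$ or $\frac12\le\sigma<\sigma_c$, equation $(\ast)$ has exactly three solutions: $\rho_{0,0}$ and two further ones, both smooth, one of which is centred around $\frac\pi2$ and the other around $-\frac\pi2$ (the two minima of $V$). -/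

import Mathlib

open MeasureTheory Real
open scoped ContDiff

noncomputable section

/-- The one-dimensional torus `ℝ / 2πℤ`; its `volume` has total mass `2π`. -/
abbrev Torus : Type := AddCircle (2 * π)

instance torusPeriodPos : Fact (0 < 2 * π) := ⟨Real.two_pi_pos⟩

/-- Cosine as a function on the torus. -/
def cosT : Torus → ℝ := Real.cos_periodic.lift

/-- Sine as a function on the torus. -/
def sinT : Torus → ℝ := Real.sin_periodic.lift

theorem continuous_cosT : Continuous cosT :=
  continuous_coinduced_dom.mpr Real.continuous_cos

/-- The environmental potential `V(x) = cos (2x)`. -/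
def potentialV (x : Torus) : ℝ := cosT ((2 : ℕ) • x)

/-- The inter-particle potential `F(x) = - cos x`. -/
def potentialF (x : Torus) : ℝ := - cosT x

theorem continuous_potentialV : Continuous potentialV :=
  continuous_cosT.comp (continuous_nsmul 2)

/-- A function on the torus is smooth if its `2π`-periodic lift to `ℝ` is `C^∞`. -/
def SmoothT (f : Torus → ℝ) : Prop := ContDiff ℝ ∞ (fun t : ℝ => f (t : Torus))

/-- The classical derivative of a function on the torus. -/
def derivT (f : Torus → ℝ) (x : Torus) : ℝ := deriv (fun t : ℝ => f (x + (t : Torus))) 0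

/-- Convolution on the torus, `(f ∗ u)(x) = ∫ f(x - y) u(y) dy`. -/
def convT (f u : Torus → ℝ) (x : Torus) : ℝ := ∫ y : Torus, f (x - y) * u y

/-- `g` is the weak derivative of `u` on the torus. -/
def HasWeakDerivT (u g : Torus → ℝ) : Prop :=
  ∀ φ : Torus → ℝ, SmoothT φ → ∫ x, u x * derivT φ x = - ∫ x, g x * φ x

/-- The Hilbert space `L²(𝕋; ℝ)`. -/
abbrev L2T : Type := Lp ℝ 2 (volume : Measure Torus)

/-- `ρ` is the density of an absolutely continuous probability measure on the torus. -/
def IsProbDensity (ρ : L2T) : Prop := (∀ᵐ x : Torus, 0 ≤ ρ x) ∧ ∫ x, ρ x = 1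

/-- `ρ` is a probability density in `H¹(𝕋)` that solves
`σ ∂ₓₓ ρ + ∂ₓ [(V' + F' ∗ ρ) ρ] = 0` weakly: it has a weak derivative `g ∈ L²(𝕋)`, and
`∫ (σ g + (V' + F' ∗ ρ) ρ) φ' = 0` for all smooth test functions `φ`. -/
def IsStationarySolution (σ : ℝ) (V F : Torus → ℝ) (ρ : L2T) : Prop :=
  IsProbDensity ρ ∧
    ∃ g : Torus → ℝ, MemLp g 2 (volume : Measure Torus) ∧ HasWeakDerivT ρ g ∧
      ∀ φ : Torus → ℝ, SmoothT φ →
        ∫ x, (σ * g x + (derivT V x + convT (derivT F) ρ x) * ρ x) * derivT φ x = 0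

/-- The set of stationary solutions at noise level `σ`, for `V(x) = cos (2x)` and
`F(x) = - cos x`; functions that agree almost everywhere are identified. -/
def stationarySolutions (σ : ℝ) : Set L2T :=
  {ρ | IsStationarySolution σ potentialV potentialF ρ}

/-- The class in `L²(𝕋)` of a continuous function. -/
def toL2T (f : C(Torus, ℝ)) : L2T := ContinuousMap.toLp (E := ℝ) 2 volume ℝ f

/-- The normalization constant `Z_σ(0,0) = ∫ exp (- cos (2x) / σ) dx`. -/
def partitionZ (σ : ℝ) : ℝ := ∫ x : Torus, Real.exp (-(potentialV x) / σ)

/-- The density `ρ_{0,0}(x) = Z_σ(0,0)⁻¹ exp (- cos (2x) / σ)`. -/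
def rhoZero (σ : ℝ) : C(Torus, ℝ) where
  toFun x := 1 / partitionZ σ * Real.exp (-(potentialV x) / σ)
  continuous_toFun := by
    have := continuous_potentialV
    fun_prop

/-- The density `f` is centred around the point `c`: it is symmetric about `c`, it attains its
maximum at `c` and nowhere else, and its mean resultant vector `∫ e^{ix} f(x) dx` is a positive
multiple of `e^{ic}`. -/
def CentredAt (c : Torus) (f : Torus → ℝ) : Prop :=
  (∀ x, f (c + x) = f (c - x)) ∧ (∀ x, x ≠ c → f x < f c) ∧
    0 < ∫ x, cosT (x - c) * f x ∧ ∫ x, sinT (x - c) * f x = 0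

/-- There are exactly three stationary solutions at noise level `σ`: `ρ_{0,0}` and two further
ones, which are smooth and centred around `π/2` and `-π/2`, respectively. -/
def ThreeStationarySolutions (σ : ℝ) : Prop :=
  (stationarySolutions σ).encard = 3 ∧
    ∃ ρp ρm : C(Torus, ℝ), SmoothT ρp ∧ SmoothT ρm ∧
      CentredAt ((π / 2 : ℝ) : Torus) ρp ∧ CentredAt ((-(π / 2) : ℝ) : Torus) ρm ∧
      stationarySolutions σ = {toL2T (rhoZero σ), toL2T ρp, toL2T ρm}

/-- The modified Bessel functions `I_n(z) = ∫ cos (2nx) exp (z cos (2x)) dx`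
(up to the factor `2π`, which cancels in the quotients `r_n`). -/
def besselI (n : ℕ) (z : ℝ) : ℝ :=
  ∫ x in (0 : ℝ)..(2 * π), Real.cos (2 * n * x) * Real.exp (z * Real.cos (2 * x))

/-- The quotient `r_n = I_{n+1} / I_n`. -/
def besselR (n : ℕ) (z : ℝ) : ℝ := besselI (n + 1) z / besselI n z

/-- The function `f_c(σ) = 1/σ - 2 + (1/σ) r_0(1/σ)`, of interest for `σ > 0`. -/
def fCrit (σ : ℝ) : ℝ := 1 / σ - 2 + 1 / σ * besselR 0 (1 / σ)

end

noncomputable section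

/-! ### Calculus on the torus -/

/-! The interaction sees `ρ` only through its first moments `a = ∫ ρ cos`, `b = ∫ ρ sin`. An
integrating factor turns the equation into the Gibbs form `ρ ∝ exp((-V + a cos + b sin)/σ)`, so
solving it means finding the pairs `(a, b)` that equal the moments of their own Gibbs density
(`mem_stationarySolutions_iff`).

Integrating the derivative of the Gibbs weight shows that its `sin cos` moment vanishes at a
self-consistent pair, while reflections show that this moment has the sign of `a * b`; hence `a * b
= 0` (`IsSelfConsistent.mul_eq_zero`). On either axis there remains one equation `selfMap κ σ t =
0`, where `σ t` is the surviving moment, with `κ = -2/σ` on the cosine axis and `κ = 2/σ` on the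
sine axis. Its left side is an odd power series whose coefficients have the signs of `m_{k+1} -
(2k+1) σ m_k`, where `m_k = ∫ cos^{2k} e^{κ cos²}`.

The three-term recurrence for the `m_k` controls these signs. For `κ = -2/σ` none is positive, so `a
= 0` (`selfCoeff_nonpos_of_repulsive`). For `κ = 2/σ` a nonpositive coefficient is followed by
negative ones only (`selfCoeff_succ_neg_of_attractive`), so by Descartes' rule of signs there is at
most one positive root; there is one exactly when the coefficient at `k = 0` is positive, that is,
when `m_1/m_0 > σ`.

The ratio `m_1/m_0` at `κ = 2/σ` decreases in `σ`, and `fCrit σ` is a positive multiple of `m_1/m_0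
- σ`. This gives a single threshold, which a continued fraction for the ratio locates numerically.
-/

theorem cosT_coe (t : ℝ) : cosT (t : Torus) = Real.cos t := rfl

theorem sinT_coe (t : ℝ) : sinT (t : Torus) = Real.sin t := rfl

@[fun_prop]
theorem cosT_continuous : Continuous cosT := continuous_cosT

@[fun_prop]
theorem sinT_continuous : Continuous sinT :=
  continuous_coinduced_dom.mpr Real.continuous_sin

theorem sinT_sq_add_cosT_sq (x : Torus) : sinT x ^ 2 + cosT x ^ 2 = 1 := by
  induction x using QuotientAddGroup.induction_on with
  | H t => exact Real.sin_sq_add_cos_sq t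

theorem cosT_sq_le_one (x : Torus) : cosT x ^ 2 ≤ 1 := by
  nlinarith [sinT_sq_add_cosT_sq x, sq_nonneg (sinT x)]

theorem abs_cosT_le_one (x : Torus) : |cosT x| ≤ 1 := by
  rw [← sq_le_one_iff_abs_le_one]; exact cosT_sq_le_one x

theorem cosT_neg (x : Torus) : cosT (-x) = cosT x := by
  induction x using QuotientAddGroup.induction_on with
  | H t => exact Real.cos_neg t

theorem sinT_neg (x : Torus) : sinT (-x) = -sinT x := by
  induction x using QuotientAddGroup.induction_on with
  | H t => exact Real.sin_neg t

theorem cosT_sub (x y : Torus) : cosT (x - y) = cosT x * cosT y + sinT x * sinT y := by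
  induction x using QuotientAddGroup.induction_on with
  | H t =>
    induction y using QuotientAddGroup.induction_on with
    | H s => exact Real.cos_sub t s

theorem sinT_sub (x y : Torus) : sinT (x - y) = sinT x * cosT y - cosT x * sinT y := by
  induction x using QuotientAddGroup.induction_on with
  | H t =>
    induction y using QuotientAddGroup.induction_on with
    | H s => exact Real.sin_sub t s

theorem cosT_add (x y : Torus) : cosT (x + y) = cosT x * cosT y - sinT x * sinT y := by
  have := cosT_sub x (-y)
  rw [sub_neg_eq_add, cosT_neg, sinT_neg] at this
  linarith

theorem sinT_add (x y : Torus) : sinT (x + y) = sinT x * cosT y + cosT x * sinT y := by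
  have := sinT_sub x (-y)
  rw [sub_neg_eq_add, cosT_neg, sinT_neg] at this
  linarith

theorem cosT_half_pi : cosT ((π / 2 : ℝ) : Torus) = 0 := Real.cos_pi_div_two

theorem sinT_half_pi : sinT ((π / 2 : ℝ) : Torus) = 1 := Real.sin_pi_div_two

theorem cosT_pi : cosT ((π : ℝ) : Torus) = -1 := Real.cos_pi

theorem sinT_pi : sinT ((π : ℝ) : Torus) = 0 := Real.sin_pi

theorem potentialV_eq (x : Torus) : potentialV x = 2 * cosT x ^ 2 - 1 := by
  rw [potentialV, two_nsmul, cosT_add]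
  linarith [sinT_sq_add_cosT_sq x]

theorem potentialV_eq_sin (x : Torus) : potentialV x = 1 - 2 * sinT x ^ 2 := by
  rw [potentialV_eq]
  linarith [sinT_sq_add_cosT_sq x]

theorem integrable_of_continuous_torus {f : Torus → ℝ} (hf : Continuous f) : Integrable f :=
  hf.integrable_of_hasCompactSupport (HasCompactSupport.of_compactSpace f)

theorem integral_torus_eq (f : Torus → ℝ) :
    ∫ x, f x = ∫ t in (0 : ℝ)..(2 * π), f (t : Torus) := by
  rw [← AddCircle.intervalIntegral_preimage (2 * π) 0 f, zero_add]

/-- The integral over the torus of a continuous function with a primitive on the torus is zero. -/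
theorem integral_torus_eq_zero_of_hasDerivAt {f f' : Torus → ℝ} (hf' : Continuous f')
    (h : ∀ t : ℝ, HasDerivAt (fun s : ℝ => f (s : Torus)) (f' (t : Torus)) t) :
    ∫ x, f' x = 0 := by
  have hc : Continuous fun t : ℝ => f' (t : Torus) := hf'.comp (AddCircle.continuous_mk' _)
  rw [integral_torus_eq, intervalIntegral.integral_eq_sub_of_hasDerivAt (fun t _ => h t)
    (hc.intervalIntegrable _ _)]
  simp [AddCircle.coe_period]

theorem integral_torus_pos {f : Torus → ℝ} (hf : Continuous f) (h0 : ∀ x, 0 ≤ f x) (x : Torus)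
    (hx : f x ≠ 0) : 0 < ∫ x, f x :=
  hf.integral_pos_of_hasCompactSupport_nonneg_nonzero (HasCompactSupport.of_compactSpace f) h0 hx

theorem derivT_coe (f : Torus → ℝ) (t : ℝ) :
    derivT f (t : Torus) = deriv (fun s : ℝ => f (s : Torus)) t := by
  have := deriv_comp_const_add (fun s : ℝ => f (s : Torus)) t 0
  simp only [add_zero] at this
  rw [← this, derivT]
  rfl

theorem SmoothT.hasDerivAt {f : Torus → ℝ} (hf : SmoothT f) (t : ℝ) :
    HasDerivAt (fun s : ℝ => f (s : Torus)) (derivT f (t : Torus)) t := by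
  rw [derivT_coe]
  exact (ContDiff.differentiable hf (by simp)).differentiableAt.hasDerivAt

theorem derivT_eq_of_hasDerivAt {f f' : Torus → ℝ}
    (h : ∀ t : ℝ, HasDerivAt (fun s : ℝ => f (s : Torus)) (f' (t : Torus)) t) : derivT f = f' := by
  ext x
  induction x using QuotientAddGroup.induction_on with
  | H t => exact (derivT_coe f t).trans (h t).deriv

theorem SmoothT.continuous {f : Torus → ℝ} (hf : SmoothT f) : Continuous f :=
  continuous_coinduced_dom.mpr (ContDiff.continuous hf)

theorem SmoothT.derivT {f : Torus → ℝ} (hf : SmoothT f) : SmoothT (derivT f) := by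
  have h : (fun t : ℝ => _root_.derivT f (t : Torus)) = deriv (fun s : ℝ => f (s : Torus)) :=
    funext (derivT_coe f)
  rw [SmoothT, h]
  exact (contDiff_infty_iff_deriv.mp hf).2

theorem SmoothT.mul {f g : Torus → ℝ} (hf : SmoothT f) (hg : SmoothT g) :
    SmoothT fun x => f x * g x :=
  ContDiff.mul hf hg

theorem SmoothT.add {f g : Torus → ℝ} (hf : SmoothT f) (hg : SmoothT g) :
    SmoothT fun x => f x + g x :=
  ContDiff.add hf hg

theorem SmoothT.exp {f : Torus → ℝ} (hf : SmoothT f) : SmoothT fun x => Real.exp (f x) :=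
  ContDiff.exp hf

theorem smoothT_const (c : ℝ) : SmoothT fun _ => c := contDiff_const

theorem smoothT_cosT : SmoothT cosT := Real.contDiff_cos

theorem smoothT_sinT : SmoothT sinT := Real.contDiff_sin

theorem SmoothT.const_mul {f : Torus → ℝ} (hf : SmoothT f) (c : ℝ) : SmoothT fun x => c * f x :=
  (smoothT_const c).mul hf

theorem smoothT_potentialV : SmoothT potentialV := by
  have : potentialV = fun x => 2 * (cosT x * cosT x) + -1 := by
    ext x; rw [potentialV_eq]; ring
  rw [this]
  exact ((smoothT_cosT.mul smoothT_cosT).const_mul 2).add (smoothT_const _)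

theorem derivT_mul {f g : Torus → ℝ} (hf : SmoothT f) (hg : SmoothT g) (x : Torus) :
    derivT (fun x => f x * g x) x = derivT f x * g x + f x * derivT g x := by
  rw [derivT_eq_of_hasDerivAt (f' := fun x => derivT f x * g x + f x * derivT g x)
    fun t => (hf.hasDerivAt t).mul (hg.hasDerivAt t)]

theorem derivT_exp {f : Torus → ℝ} (hf : SmoothT f) (x : Torus) :
    derivT (fun x => Real.exp (f x)) x = Real.exp (f x) * derivT f x := by
  rw [derivT_eq_of_hasDerivAt (f' := fun x => Real.exp (f x) * derivT f x)
    fun t => (hf.hasDerivAt t).exp]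

theorem integral_derivT {f : Torus → ℝ} (hf : SmoothT f) : ∫ x, derivT f x = 0 :=
  integral_torus_eq_zero_of_hasDerivAt hf.derivT.continuous hf.hasDerivAt

theorem derivT_potentialF : derivT potentialF = sinT :=
  derivT_eq_of_hasDerivAt fun t => by
    simpa [potentialF, cosT_coe, sinT_coe] using (Real.hasDerivAt_cos t).fun_neg

theorem derivT_potentialV : derivT potentialV = fun x => -4 * (sinT x * cosT x) :=
  derivT_eq_of_hasDerivAt fun t => by
    simp only [potentialV_eq, cosT_coe, sinT_coe]
    refine ((((Real.hasDerivAt_cos t).pow 2).const_mul 2).sub_const 1).congr_deriv ?_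
    push_cast; ring

theorem MeasureTheory.Integrable.mul_continuous_torus {f g : Torus → ℝ} (hf : Integrable f)
    (hg : Continuous g) : Integrable fun x => f x * g x := by
  obtain ⟨c, hc⟩ := isCompact_univ.exists_bound_of_continuousOn hg.continuousOn
  exact hf.mul_bdd hg.aestronglyMeasurable (Filter.Eventually.of_forall fun x => hc x trivial)

/-- **Du Bois-Reymond lemma** on the torus, for square-integrable functions. -/
theorem ae_eq_const_of_integral_mul_derivT_eq_zero {f : Torus → ℝ}
    (hf : MemLp f 2 (volume : Measure Torus))
    (h : ∀ φ : Torus → ℝ, SmoothT φ → ∫ x, f x * derivT φ x = 0) :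
    ∃ C : ℝ, ∀ᵐ x : Torus, f x = C := by
  set m : ℝ := (2 * π)⁻¹ * ∫ x, f x with hm
  have hint : Integrable f := hf.integrable (by norm_num)
  have hm0 : ∫ x, (f x - m) = 0 := by
    rw [integral_sub hint (integrable_const m), integral_const, hm]
    have : (volume : Measure Torus).real Set.univ = 2 * π := by
      simp [Measure.real, AddCircle.measure_univ, Real.pi_pos.le]
    rw [this, smul_eq_mul]
    field_simp
    ring
  have hh : ∀ φ : Torus → ℝ, SmoothT φ → ∫ x, (f x - m) * derivT φ x = 0 := by
    intro φ hφ
    simp only [sub_mul]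
    have hi : Integrable fun x => m * derivT φ x :=
      integrable_of_continuous_torus (continuous_const.mul hφ.derivT.continuous)
    rw [integral_sub (hint.mul_continuous_torus hφ.derivT.continuous) hi,
      h φ hφ, integral_const_mul, integral_derivT hφ]
    simp
  -- Testing with `sin(nx)/n` and `-cos(nx)/n` kills every Fourier coefficient of `f - m` with `n ≠
  -- 0`; the one with `n = 0` vanishes by the choice of `m` as the mean.
  have hcos : ∀ n : ℤ, n ≠ 0 → ∫ x : Torus, (f x - m) * cosT (n • x) = 0 := by
    intro n hn
    have hn' : (n : ℝ) ≠ 0 := by exact_mod_cast hn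
    have hs : SmoothT fun x : Torus => (n : ℝ)⁻¹ * sinT (n • x) := by
      change ContDiff ℝ ∞ fun t : ℝ => (n : ℝ)⁻¹ * Real.sin (n • t)
      simp only [zsmul_eq_mul]
      fun_prop
    rw [← hh _ hs, derivT_eq_of_hasDerivAt (f' := fun x : Torus => cosT (n • x))]
    intro t
    change HasDerivAt (fun s : ℝ => (n : ℝ)⁻¹ * Real.sin (n • s)) (Real.cos (n • t)) t
    simp only [zsmul_eq_mul]
    refine ((((hasDerivAt_id t).const_mul (n : ℝ)).sin).const_mul (n : ℝ)⁻¹).congr_deriv ?_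
    simp only [id]; field_simp
  have hsin : ∀ n : ℤ, n ≠ 0 → ∫ x : Torus, (f x - m) * sinT (n • x) = 0 := by
    intro n hn
    have hn' : (n : ℝ) ≠ 0 := by exact_mod_cast hn
    have hs : SmoothT fun x : Torus => -(n : ℝ)⁻¹ * cosT (n • x) := by
      change ContDiff ℝ ∞ fun t : ℝ => -(n : ℝ)⁻¹ * Real.cos (n • t)
      simp only [zsmul_eq_mul]
      fun_prop
    rw [← hh _ hs, derivT_eq_of_hasDerivAt (f' := fun x : Torus => sinT (n • x))]
    intro t
    change HasDerivAt (fun s : ℝ => -(n : ℝ)⁻¹ * Real.cos (n • s)) (Real.sin (n • t)) t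
    simp only [zsmul_eq_mul]
    refine ((((hasDerivAt_id t).const_mul (n : ℝ)).cos).const_mul (-(n : ℝ)⁻¹)).congr_deriv ?_
    simp only [id]; field_simp
  have hfour : ∀ (n : ℤ) (x : Torus),
      fourier n x = (cosT (n • x) : ℂ) + (sinT (n • x) : ℂ) * Complex.I := by
    intro n x
    induction x using QuotientAddGroup.induction_on with
    | H t =>
      change fourier n (t : AddCircle (2 * π)) =
        (Real.cos (n • t) : ℂ) + (Real.sin (n • t) : ℂ) * Complex.I
      rw [fourier_coe_apply, zsmul_eq_mul, ← Complex.exp_ofReal_mul_I]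
      congr 1
      have : (π : ℂ) ≠ 0 := by exact_mod_cast Real.pi_ne_zero
      push_cast
      field_simp
  have hgL : MemLp (fun x : Torus => ((f x - m : ℝ) : ℂ)) 2 (volume : Measure Torus) :=
    (hf.sub (memLp_const m)).ofReal
  have hgL' := hgL.haarAddCircle
  have key : hgL'.toLp _ = 0 := by
    apply (fourierBasis (T := 2 * π)).repr.injective
    rw [map_zero]
    ext n
    rw [fourierBasis_repr]
    rw [fourierCoeff_congr_ae hgL'.coeFn_toLp, fourierCoeff, AddCircle.integral_haarAddCircle]
    have hA : ∫ x : Torus, (f x - m) * cosT (-n • x) = 0 := by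
      rcases eq_or_ne n 0 with rfl | hn
      · have : cosT 0 = 1 := Real.cos_zero
        simpa [this] using hm0
      · exact hcos (-n) (neg_ne_zero.mpr hn)
    have hB : ∫ x : Torus, (f x - m) * sinT (-n • x) = 0 := by
      rcases eq_or_ne n 0 with rfl | hn
      · have : sinT 0 = 0 := Real.sin_zero
        simp [this]
      · exact hsin (-n) (neg_ne_zero.mpr hn)
    have hint' : Integrable fun x => f x - m := hint.sub (integrable_const m)
    have hiA : Integrable fun x : Torus => (f x - m) * cosT (-n • x) :=
      hint'.mul_continuous_torus (by fun_prop)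
    have hiB : Integrable fun x : Torus => (f x - m) * sinT (-n • x) :=
      hint'.mul_continuous_torus (by fun_prop)
    have heq : ∀ x : Torus, fourier (-n) x • ((f x - m : ℝ) : ℂ) =
        (((f x - m) * cosT (-n • x) : ℝ) : ℂ) +
          (((f x - m) * sinT (-n • x) : ℝ) : ℂ) * Complex.I := by
      intro x
      rw [hfour, smul_eq_mul]
      push_cast
      ring
    have hz : ∫ x : Torus, fourier (-n) x • ((f x - m : ℝ) : ℂ) = 0 := by
      simp only [heq]
      rw [integral_add hiA.ofReal (hiB.ofReal.mul_const _), integral_mul_const,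
        integral_complex_ofReal, integral_complex_ofReal, hA, hB]
      simp
    rw [hz]
    simp
  have h2 : ∀ᵐ x ∂(AddCircle.haarAddCircle (T := 2 * π)), ((f x - m : ℝ) : ℂ) = 0 := by
    have := hgL'.coeFn_toLp
    rw [key] at this
    filter_upwards [this, Lp.coeFn_zero ℂ 2 (AddCircle.haarAddCircle (T := 2 * π))] with x h1 h2
    rw [← h1, h2]; rfl
  refine ⟨m, ?_⟩
  rw [AddCircle.volume_eq_smul_haarAddCircle]
  refine Measure.ae_smul_measure ?_ _
  filter_upwards [h2] with x hx
  have : f x - m = 0 := by exact_mod_cast hx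
  linarith

/-! ### Stationary solutions are Gibbs densities -/

/-- The exponent `(-V(x) + a cos x + b sin x) / σ` of a Gibbs density. -/
def gibbsExponent (σ a b : ℝ) (x : Torus) : ℝ :=
  σ⁻¹ * (-1 * potentialV x + (a * cosT x + b * sinT x))

/-- The unnormalized Gibbs weight. -/
def gibbsWeight (σ a b : ℝ) (x : Torus) : ℝ := Real.exp (gibbsExponent σ a b x)

theorem smoothT_gibbsExponent (σ a b : ℝ) : SmoothT (gibbsExponent σ a b) :=
  ((smoothT_potentialV.const_mul _).add
    ((smoothT_cosT.const_mul a).add (smoothT_sinT.const_mul b))).const_mul _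

theorem smoothT_gibbsWeight (σ a b : ℝ) : SmoothT (gibbsWeight σ a b) :=
  (smoothT_gibbsExponent σ a b).exp

@[fun_prop]
theorem continuous_gibbsWeight (σ a b : ℝ) : Continuous (gibbsWeight σ a b) :=
  (smoothT_gibbsWeight σ a b).continuous

theorem gibbsWeight_pos (σ a b : ℝ) (x : Torus) : 0 < gibbsWeight σ a b x := Real.exp_pos _

theorem derivT_gibbsExponent (σ a b : ℝ) : derivT (gibbsExponent σ a b) =
    fun x => -(σ⁻¹ * (-4 * (sinT x * cosT x) + (a * sinT x - b * cosT x))) := by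
  apply derivT_eq_of_hasDerivAt
  intro t
  have hV := smoothT_potentialV.hasDerivAt t
  rw [derivT_potentialV] at hV
  refine (((hV.const_mul (-1)).add (((Real.hasDerivAt_cos t).const_mul a).add
    ((Real.hasDerivAt_sin t).const_mul b))).const_mul σ⁻¹).congr_deriv ?_
  simp only [cosT_coe, sinT_coe]
  ring

theorem convT_sinT {ρ : Torus → ℝ} (hρ : Integrable ρ) (x : Torus) :
    convT sinT ρ x = (∫ y, ρ y * cosT y) * sinT x - (∫ y, ρ y * sinT y) * cosT x := by
  have h : ∀ y, sinT (x - y) * ρ y = ρ y * cosT y * sinT x - ρ y * sinT y * cosT x := by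
    intro y; rw [sinT_sub]; ring
  simp only [convT, h]
  rw [integral_sub ((hρ.mul_continuous_torus cosT_continuous).mul_const _)
    ((hρ.mul_continuous_torus sinT_continuous).mul_const _), integral_mul_const, integral_mul_const]

theorem MeasureTheory.MemLp.mul_continuous_torus {f g : Torus → ℝ}
    (hf : MemLp f 2 (volume : Measure Torus)) (hg : Continuous g) :
    MemLp (fun x => f x * g x) 2 (volume : Measure Torus) := by
  obtain ⟨c, hc⟩ := isCompact_univ.exists_bound_of_continuousOn hg.continuousOn
  have hg' : MemLp g ⊤ (volume : Measure Torus) :=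
    memLp_top_of_bound hg.aestronglyMeasurable c (Filter.Eventually.of_forall fun x => hc x trivial)
  exact hg'.mul' hf

/-- The weak equation makes the flux `σ g + W ρ` a constant `C`. With the integrating factor `E =
e^{-gibbsExponent}` it reads `(ρ E)' = C E / σ` weakly. Periodicity forces `C = 0` because `E > 0`,
and then `ρ E` is constant. -/
theorem exists_ae_eq_mul_gibbsWeight {σ : ℝ} (hσ : 0 < σ) {ρ : L2T}
    (hρ : ρ ∈ stationarySolutions σ) :
    ∃ K : ℝ, ∀ᵐ x : Torus,
      ρ x = K * gibbsWeight σ (∫ y, ρ y * cosT y) (∫ y, ρ y * sinT y) x := by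
  obtain ⟨-, g, hg, hweak, hflux⟩ := hρ
  have hρL : MemLp ρ 2 (volume : Measure Torus) := Lp.memLp ρ
  have hρi : Integrable ρ := hρL.integrable (by norm_num)
  have hgi : Integrable g := hg.integrable (by norm_num)
  set a := ∫ y, ρ y * cosT y with ha
  set b := ∫ y, ρ y * sinT y with hb
  set W : Torus → ℝ := fun x => -4 * (sinT x * cosT x) + (a * sinT x - b * cosT x) with hW
  have hWc : Continuous W := by fun_prop
  have hdrift : ∀ x, derivT potentialV x + convT (derivT potentialF) ρ x = W x := by
    intro x
    rw [derivT_potentialV, derivT_potentialF, convT_sinT hρi]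
  set h : Torus → ℝ := fun x => σ * g x + ρ x * W x with hh
  have hhL : MemLp h 2 (volume : Measure Torus) :=
    (hg.const_mul σ).add (hρL.mul_continuous_torus hWc)
  obtain ⟨C, hC⟩ := ae_eq_const_of_integral_mul_derivT_eq_zero hhL fun φ hφ => by
    rw [← hflux φ hφ]
    simp only [hdrift, hh, mul_comm (W _)]
  set E : Torus → ℝ := fun x => Real.exp (-1 * gibbsExponent σ a b x) with hE
  have hEs : SmoothT E := ((smoothT_gibbsExponent σ a b).const_mul _).exp
  have hEd : ∀ x, derivT E x = E x * (σ⁻¹ * W x) := by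
    intro x
    rw [hE, derivT_exp ((smoothT_gibbsExponent σ a b).const_mul _),
      derivT_mul (smoothT_const _) (smoothT_gibbsExponent σ a b), derivT_gibbsExponent,
      derivT_eq_of_hasDerivAt (f' := fun _ => 0) fun t => hasDerivAt_const t _]
    simp only [hW]
    ring
  have key : ∀ φ : Torus → ℝ, SmoothT φ →
      ∫ x, (ρ x * E x) * derivT φ x = -(σ⁻¹ * (C * ∫ x, E x * φ x)) := by
    intro φ hφ
    have hEφ : Continuous fun x => E x * φ x := (hEs.mul hφ).continuous
    have h1 := hweak _ (hEs.mul hφ)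
    have h2 : ∀ x, (ρ x * E x) * derivT φ x =
        ρ x * derivT (fun x => E x * φ x) x - ρ x * (σ⁻¹ * W x * (E x * φ x)) := by
      intro x
      rw [derivT_mul hEs hφ, hEd]
      ring
    have h3 : ∫ x, h x * (E x * φ x) = C * ∫ x, E x * φ x := by
      rw [← integral_const_mul]
      refine integral_congr_ae ?_
      filter_upwards [hC] with x hx
      rw [hx]
    have h4 : ∀ x, h x * (E x * φ x) =
        σ * (g x * (E x * φ x) + ρ x * (σ⁻¹ * W x * (E x * φ x))) := by
      intro x
      simp only [hh]
      field_simp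
    have i1 : Integrable fun x => ρ x * derivT (fun x => E x * φ x) x :=
      hρi.mul_continuous_torus (hEs.mul hφ).derivT.continuous
    have i2 : Integrable fun x => ρ x * (σ⁻¹ * W x * (E x * φ x)) :=
      hρi.mul_continuous_torus ((continuous_const.mul hWc).mul hEφ)
    have i3 : Integrable fun x => g x * (E x * φ x) := hgi.mul_continuous_torus hEφ
    simp only [h4] at h3
    rw [integral_const_mul, integral_add i3 i2] at h3
    simp only [h2]
    rw [integral_sub i1 i2, h1, ← h3]
    field_simp
    ring
  -- The test function `1` gives `C ∫ E = 0`.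
  have hC0 : C = 0 := by
    have h1 := key (fun _ => 1) (smoothT_const 1)
    rw [derivT_eq_of_hasDerivAt (f' := fun _ => 0) fun t => hasDerivAt_const t _] at h1
    have hpos : 0 < ∫ x, E x * 1 :=
      integral_torus_pos (hEs.continuous.mul continuous_const)
        (fun x => by simpa using (Real.exp_pos _).le) 0 (by simp [hE])
    simp only [mul_one] at hpos
    simpa [hσ.ne', hpos.ne'] using h1
  obtain ⟨K, hK⟩ := ae_eq_const_of_integral_mul_derivT_eq_zero
    (hρL.mul_continuous_torus hEs.continuous) fun φ hφ => by rw [key φ hφ, hC0]; simp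
  refine ⟨K, ?_⟩
  filter_upwards [hK] with x hx
  rw [← hx, mul_assoc, hE, gibbsWeight, ← Real.exp_add]
  simp

/-- The normalized Gibbs density. -/
def gibbsDensity (σ a b : ℝ) : C(Torus, ℝ) where
  toFun x := (∫ y, gibbsWeight σ a b y)⁻¹ * gibbsWeight σ a b x
  continuous_toFun := by fun_prop

theorem gibbsDensity_apply (σ a b : ℝ) (x : Torus) :
    gibbsDensity σ a b x = (∫ y, gibbsWeight σ a b y)⁻¹ * gibbsWeight σ a b x := rfl

theorem integral_gibbsWeight_pos (σ a b : ℝ) : 0 < ∫ x, gibbsWeight σ a b x :=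
  integral_torus_pos (by fun_prop) (fun x => (gibbsWeight_pos σ a b x).le) 0
    (gibbsWeight_pos σ a b 0).ne'

theorem smoothT_gibbsDensity (σ a b : ℝ) : SmoothT (gibbsDensity σ a b) :=
  (smoothT_gibbsWeight σ a b).const_mul _

theorem rhoZero_eq_gibbsDensity (σ : ℝ) : rhoZero σ = gibbsDensity σ 0 0 := by
  have h : ∀ x, Real.exp (-(potentialV x) / σ) = gibbsWeight σ 0 0 x := by
    intro x; rw [gibbsWeight, gibbsExponent]; congr 1; ring
  ext x
  change 1 / partitionZ σ * Real.exp (-(potentialV x) / σ) = _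
  rw [partitionZ, gibbsDensity_apply]
  simp only [h, one_div]

theorem toL2T_ae_eq (f : C(Torus, ℝ)) : ∀ᵐ x : Torus, toL2T f x = f x :=
  ContinuousMap.coeFn_toLp (𝕜 := ℝ) volume f

theorem toL2T_injective : Function.Injective toL2T :=
  ContinuousMap.toLp_injective (p := 2) (𝕜 := ℝ) (volume : Measure Torus)

/-- Self-consistency of the parameters `(a, b)`. -/
def IsSelfConsistent (σ a b : ℝ) : Prop :=
  ∫ x, (cosT x - a) * gibbsWeight σ a b x = 0 ∧ ∫ x, (sinT x - b) * gibbsWeight σ a b x = 0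

theorem integral_sub_mul_gibbsWeight (σ a b m : ℝ) {f : Torus → ℝ} (hf : Continuous f) :
    ∫ x, (f x - m) * gibbsWeight σ a b x =
      (∫ x, gibbsWeight σ a b x) * ((∫ x, f x * gibbsDensity σ a b x) - m) := by
  have h1 : Integrable fun x => f x * gibbsWeight σ a b x :=
    integrable_of_continuous_torus (by fun_prop)
  have h2 : Integrable fun x => m * gibbsWeight σ a b x :=
    integrable_of_continuous_torus (by fun_prop)
  have h3 : ∀ x, f x * gibbsDensity σ a b x =
      (∫ y, gibbsWeight σ a b y)⁻¹ * (f x * gibbsWeight σ a b x) := by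
    intro x; rw [gibbsDensity_apply]; ring
  simp only [sub_mul, h3]
  rw [integral_sub h1 h2, integral_const_mul, integral_const_mul]
  have := (integral_gibbsWeight_pos σ a b).ne'
  field_simp

theorem isSelfConsistent_iff (σ a b : ℝ) : IsSelfConsistent σ a b ↔
    ∫ x, cosT x * gibbsDensity σ a b x = a ∧ ∫ x, sinT x * gibbsDensity σ a b x = b := by
  have := (integral_gibbsWeight_pos σ a b).ne'
  rw [IsSelfConsistent, integral_sub_mul_gibbsWeight σ a b a cosT_continuous,
    integral_sub_mul_gibbsWeight σ a b b sinT_continuous]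
  simp [this, sub_eq_zero]

theorem integral_gibbsDensity (σ a b : ℝ) : ∫ x, gibbsDensity σ a b x = 1 := by
  simp only [gibbsDensity_apply]
  rw [integral_const_mul, inv_mul_cancel₀ (integral_gibbsWeight_pos σ a b).ne']

/-- Self-consistency makes the drift equal to `-σ` times the derivative of the exponent, so the flux
vanishes pointwise. -/
theorem toL2T_gibbsDensity_mem {σ : ℝ} (hσ : 0 < σ) {a b : ℝ} (h : IsSelfConsistent σ a b) :
    toL2T (gibbsDensity σ a b) ∈ stationarySolutions σ := by
  rw [isSelfConsistent_iff] at h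
  set f := gibbsDensity σ a b with hf
  have hae := toL2T_ae_eq f
  have hfs : SmoothT f := smoothT_gibbsDensity σ a b
  refine ⟨⟨?_, ?_⟩, derivT f, ?_, ?_, ?_⟩
  · filter_upwards [hae] with x hx
    rw [hx, hf, gibbsDensity_apply]
    exact mul_nonneg (inv_nonneg.mpr (integral_gibbsWeight_pos σ a b).le) (gibbsWeight_pos _ _ _ x).le
  · rw [integral_congr_ae hae, integral_gibbsDensity]
  · exact hfs.derivT.continuous.memLp_of_hasCompactSupport (HasCompactSupport.of_compactSpace _)
  · intro φ hφ
    have h1 := integral_derivT (hfs.mul hφ)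
    simp only [derivT_mul hfs hφ] at h1
    have i1 : Integrable fun x => derivT f x * φ x :=
      integrable_of_continuous_torus (hfs.derivT.continuous.mul hφ.continuous)
    have i2 : Integrable fun x => f x * derivT φ x :=
      integrable_of_continuous_torus (hfs.continuous.mul hφ.derivT.continuous)
    rw [integral_add i1 i2] at h1
    have h2 : ∫ x, toL2T f x * derivT φ x = ∫ x, f x * derivT φ x :=
      integral_congr_ae (by filter_upwards [hae] with x hx; rw [hx])
    rw [h2]
    linarith
  · intro φ hφ
    have hconv : ∀ x, convT (derivT potentialF) (toL2T f) x = a * sinT x - b * cosT x := by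
      intro x
      rw [derivT_potentialF]
      have : convT sinT (toL2T f) x = convT sinT f x :=
        integral_congr_ae (by filter_upwards [hae] with x hx; rw [hx])
      rw [this, convT_sinT (integrable_of_continuous_torus f.continuous)]
      simp only [mul_comm (f _), h.1, h.2]
    have hd : ∀ x, derivT f x = f x * derivT (gibbsExponent σ a b) x := by
      intro x
      have : (f : Torus → ℝ) = fun x => (∫ y, gibbsWeight σ a b y)⁻¹ * gibbsWeight σ a b x := rfl
      rw [this, derivT_mul (smoothT_const _) (smoothT_gibbsWeight σ a b),
        derivT_eq_of_hasDerivAt (f' := fun _ => 0) fun t => hasDerivAt_const t _]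
      have h3 : derivT (gibbsWeight σ a b) x =
          gibbsWeight σ a b x * derivT (gibbsExponent σ a b) x :=
        derivT_exp (smoothT_gibbsExponent σ a b) x
      rw [h3]
      ring
    have hzero : (fun x => (σ * derivT f x + (derivT potentialV x +
        convT (derivT potentialF) (toL2T f) x) * toL2T f x) * derivT φ x) =ᵐ[volume]
        fun _ => (0 : ℝ) := by
      filter_upwards [hae] with x hx
      rw [hx, hconv, hd, derivT_gibbsExponent, derivT_potentialV]
      field_simp
      ring
    rw [integral_congr_ae hzero, integral_zero]

theorem mem_stationarySolutions_iff {σ : ℝ} (hσ : 0 < σ) (ρ : L2T) :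
    ρ ∈ stationarySolutions σ ↔ ∃ a b, IsSelfConsistent σ a b ∧ ρ = toL2T (gibbsDensity σ a b) := by
  constructor
  · intro hρ
    obtain ⟨K, hK⟩ := exists_ae_eq_mul_gibbsWeight hσ hρ
    set a := ∫ y, ρ y * cosT y with ha
    set b := ∫ y, ρ y * sinT y with hb
    have hK1 : K * ∫ x, gibbsWeight σ a b x = 1 := by
      rw [← hρ.1.2, integral_congr_ae hK, integral_const_mul]
    have hK2 : ∀ᵐ x : Torus, ρ x = gibbsDensity σ a b x := by
      filter_upwards [hK] with x hx
      rw [hx, gibbsDensity_apply, ← eq_inv_of_mul_eq_one_left hK1]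
    refine ⟨a, b, ?_, ?_⟩
    · rw [isSelfConsistent_iff]
      constructor
      · conv_rhs => rw [ha]
        exact integral_congr_ae (by filter_upwards [hK2] with x hx; rw [hx, mul_comm])
      · conv_rhs => rw [hb]
        exact integral_congr_ae (by filter_upwards [hK2] with x hx; rw [hx, mul_comm])
    · apply Lp.ext
      filter_upwards [hK2, toL2T_ae_eq (gibbsDensity σ a b)] with x h1 h2
      rw [h1, h2]
  · rintro ⟨a, b, h, rfl⟩
    exact toL2T_gibbsDensity_mem hσ h

/-! ### Moments of the cosine -/

/-- Four terms suffice for every identity below; shorter ones are padded with zero coefficients. -/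
theorem integral_linear_combination {f g h k : Torus → ℝ} (hf : Integrable f) (hg : Integrable g)
    (hh : Integrable h) (hk : Integrable k) (a b c d : ℝ) :
    ∫ x, (a * f x + b * g x + c * h x + d * k x) =
      a * (∫ x, f x) + b * (∫ x, g x) + c * (∫ x, h x) + d * ∫ x, k x := by
  have i1 : Integrable fun x => a * f x + b * g x := (hf.const_mul a).add (hg.const_mul b)
  have i2 : Integrable fun x => a * f x + b * g x + c * h x := i1.add (hh.const_mul c)
  rw [integral_add i2 (hk.const_mul d), integral_add i1 (hh.const_mul c),
    integral_add (hf.const_mul a) (hg.const_mul b)]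
  simp only [integral_const_mul]

/-- The even moments `∫ cos^{2k} e^{κ cos²}`. -/
def cosMoment (κ : ℝ) (k : ℕ) : ℝ := ∫ x : Torus, cosT x ^ (2 * k) * Real.exp (κ * cosT x ^ 2)

theorem integrable_cosMoment (κ : ℝ) (k : ℕ) :
    Integrable fun x : Torus => cosT x ^ (2 * k) * Real.exp (κ * cosT x ^ 2) :=
  integrable_of_continuous_torus (by fun_prop)

theorem cosMoment_pos (κ : ℝ) (k : ℕ) : 0 < cosMoment κ k := by
  refine integral_torus_pos (by fun_prop) (fun x => ?_) 0 ?_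
  · rw [pow_mul]; positivity
  · have : cosT 0 = 1 := Real.cos_zero
    simp [this]

theorem cosMoment_succ_le (κ : ℝ) (k : ℕ) : cosMoment κ (k + 1) ≤ cosMoment κ k := by
  refine integral_mono (integrable_cosMoment κ (k + 1)) (integrable_cosMoment κ k) fun x => ?_
  dsimp only
  have h1 := cosT_sq_le_one x
  have h2 : 0 ≤ cosT x ^ (2 * k) := by rw [pow_mul]; positivity
  have h3 : cosT x ^ (2 * (k + 1)) = cosT x ^ (2 * k) * cosT x ^ 2 := by ring
  rw [h3]
  gcongr
  nlinarith

/-- Integration by parts for the moments. -/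
theorem cosMoment_recurrence (κ : ℝ) (k : ℕ) :
    (2 * k + 2) * cosMoment κ (k + 1) - 2 * κ * (cosMoment κ (k + 1) - cosMoment κ (k + 2)) =
      (2 * k + 1) * cosMoment κ k := by
  set e : Torus → ℝ := fun x => Real.exp (κ * cosT x ^ 2) with he
  -- The recurrence is the vanishing integral of the derivative of `sin · cos^{2k+1} · e^{κ cos²}`,
  -- with `sin²` rewritten as `1 - cos²`.
  have h := integral_torus_eq_zero_of_hasDerivAt
    (f := fun x => sinT x * (cosT x ^ (2 * k + 1) * e x))
    (f' := fun x => (2 * k + 2) * (cosT x ^ (2 * (k + 1)) * e x) +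
      (-2 * κ) * (cosT x ^ (2 * (k + 1)) * e x) + (2 * κ) * (cosT x ^ (2 * (k + 2)) * e x) +
      (-(2 * k + 1)) * (cosT x ^ (2 * k) * e x)) (by fun_prop) ?_
  · have i1 := integrable_cosMoment κ (k + 1)
    rw [integral_linear_combination i1 i1 (integrable_cosMoment κ (k + 2))
      (integrable_cosMoment κ k)] at h
    simp only [cosMoment]
    linarith
  · intro t
    have h1 := (Real.hasDerivAt_sin t).mul (((Real.hasDerivAt_cos t).pow (2 * k + 1)).mul
      ((((Real.hasDerivAt_cos t).pow 2).const_mul κ).exp))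
    refine h1.congr_deriv ?_
    simp only [he, cosT_coe, Pi.pow_apply, Pi.mul_apply]
    have hs := Real.sin_sq t
    set E := Real.exp (κ * Real.cos t ^ 2)
    have h2 : 2 * k + 1 - 1 = 2 * k := by omega
    rw [h2]
    push_cast
    linear_combination (-(2 * k + 1) * Real.cos t ^ (2 * k) * E
      - 2 * κ * Real.cos t ^ (2 * k + 2) * E) * hs

/-- Cauchy–Schwarz, in the form of integrating the nonnegative function `(m cos² - r)²` against the
weight of the `k`-th moment. -/
theorem cosMoment_sq_le (κ : ℝ) (k : ℕ) :
    cosMoment κ (k + 1) ^ 2 ≤ cosMoment κ k * cosMoment κ (k + 2) := by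
  set r := cosMoment κ (k + 1)
  set m := cosMoment κ k with hm
  have hmpos : 0 < m := cosMoment_pos κ k
  have i0 := integrable_cosMoment κ k
  have i1 := integrable_cosMoment κ (k + 1)
  have i2 := integrable_cosMoment κ (k + 2)
  have h : 0 ≤ ∫ x : Torus, cosT x ^ (2 * k) * Real.exp (κ * cosT x ^ 2) *
      (m * cosT x ^ 2 - r) ^ 2 :=
    integral_nonneg fun x => by
      dsimp only
      rw [pow_mul]; positivity
  have h2 : ∀ x : Torus, cosT x ^ (2 * k) * Real.exp (κ * cosT x ^ 2) *
      (m * cosT x ^ 2 - r) ^ 2 = m ^ 2 * (cosT x ^ (2 * (k + 2)) * Real.exp (κ * cosT x ^ 2)) +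
      (-2 * m * r) * (cosT x ^ (2 * (k + 1)) * Real.exp (κ * cosT x ^ 2)) +
      r ^ 2 * (cosT x ^ (2 * k) * Real.exp (κ * cosT x ^ 2)) +
      0 * (cosT x ^ (2 * k) * Real.exp (κ * cosT x ^ 2)) := by
    intro x; ring
  simp only [h2] at h
  rw [integral_linear_combination i2 i1 i0 i0] at h
  change 0 ≤ m ^ 2 * cosMoment κ (k + 2) + (-2 * m * r) * r + r ^ 2 * m + 0 * m at h
  have h3 : 0 ≤ m * (m * cosMoment κ (k + 2) - r ^ 2) := by linarith
  have := nonneg_of_mul_nonneg_right h3 hmpos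
  linarith

/-- Tilting by `e^{δ cos²}`, `δ ≥ 0`, increases the mean of `cos²`. -/
theorem cosMoment_ratio_mono {κ₁ κ₂ : ℝ} (h : κ₁ ≤ κ₂) :
    cosMoment κ₁ 1 * cosMoment κ₂ 0 ≤ cosMoment κ₂ 1 * cosMoment κ₁ 0 := by
  -- `m` is the mean of `cos²` at `κ₁`. The two factors of `(e^{(κ₂-κ₁) cos²} - d)(cos² - m)` change
  -- sign together at `cos² = m`, so the product is nonnegative; its `d` part integrates to zero at
  -- `κ₁`.
  set m := cosMoment κ₁ 1 / cosMoment κ₁ 0 with hm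
  have h0 := cosMoment_pos κ₁ 0
  have i1 := integrable_cosMoment κ₁ 1
  have i0 := integrable_cosMoment κ₁ 0
  have j1 := integrable_cosMoment κ₂ 1
  have j0 := integrable_cosMoment κ₂ 0
  set d := Real.exp ((κ₂ - κ₁) * m) with hd
  have hi : 0 ≤ ∫ x : Torus, (1 * (cosT x ^ (2 * 1) * Real.exp (κ₂ * cosT x ^ 2)) +
      (-m) * (cosT x ^ (2 * 0) * Real.exp (κ₂ * cosT x ^ 2)) +
      (-d) * (cosT x ^ (2 * 1) * Real.exp (κ₁ * cosT x ^ 2)) +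
      (d * m) * (cosT x ^ (2 * 0) * Real.exp (κ₁ * cosT x ^ 2))) := by
    refine integral_nonneg fun x => ?_
    have hsplit : Real.exp (κ₂ * cosT x ^ 2) =
        Real.exp (κ₁ * cosT x ^ 2) * Real.exp ((κ₂ - κ₁) * cosT x ^ 2) := by
      rw [← Real.exp_add]; congr 1; ring
    have hform : (1 * (cosT x ^ (2 * 1) * Real.exp (κ₂ * cosT x ^ 2)) +
        (-m) * (cosT x ^ (2 * 0) * Real.exp (κ₂ * cosT x ^ 2)) +
        (-d) * (cosT x ^ (2 * 1) * Real.exp (κ₁ * cosT x ^ 2)) +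
        (d * m) * (cosT x ^ (2 * 0) * Real.exp (κ₁ * cosT x ^ 2))) =
        Real.exp (κ₁ * cosT x ^ 2) *
          ((Real.exp ((κ₂ - κ₁) * cosT x ^ 2) - d) * (cosT x ^ 2 - m)) := by
      rw [hsplit]; ring
    dsimp only [Pi.zero_apply]
    rw [hform]
    refine mul_nonneg (Real.exp_pos _).le ?_
    rcases le_total m (cosT x ^ 2) with hc | hc
    · refine mul_nonneg (sub_nonneg.mpr (Real.exp_le_exp.mpr ?_)) (sub_nonneg.mpr hc)
      exact mul_le_mul_of_nonneg_left hc (sub_nonneg.mpr h)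
    · refine mul_nonneg_of_nonpos_of_nonpos (sub_nonpos.mpr (Real.exp_le_exp.mpr ?_))
        (sub_nonpos.mpr hc)
      exact mul_le_mul_of_nonneg_left hc (sub_nonneg.mpr h)
  rw [integral_linear_combination j1 j0 i1 i0] at hi
  change 0 ≤ 1 * cosMoment κ₂ 1 + (-m) * cosMoment κ₂ 0 + (-d) * cosMoment κ₁ 1 +
    d * m * cosMoment κ₁ 0 at hi
  have hm' : m * cosMoment κ₁ 0 = cosMoment κ₁ 1 := div_mul_cancel₀ _ h0.ne'
  rw [mul_assoc d, hm'] at hi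
  have hi' : m * cosMoment κ₂ 0 ≤ cosMoment κ₂ 1 := by linarith
  calc cosMoment κ₁ 1 * cosMoment κ₂ 0 = m * cosMoment κ₂ 0 * cosMoment κ₁ 0 := by
        rw [← hm']; ring
    _ ≤ _ := mul_le_mul_of_nonneg_right hi' h0.le

theorem continuous_integral_torus {f : ℝ → Torus → ℝ} (hf : Continuous f.uncurry) : Continuous fun p => ∫ x, f p x := by
  simpa using continuous_parametric_integral_of_continuous (μ := (volume : Measure Torus)) hf
    isCompact_univ

theorem continuous_cosMoment (k : ℕ) : Continuous fun κ => cosMoment κ k :=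
  continuous_integral_torus (f := fun κ x => cosT x ^ (2 * k) * Real.exp (κ * cosT x ^ 2))
    (by unfold Function.uncurry; fun_prop)

/-! ### The self-consistency function -/

/-- The self-consistency function `∫ (cos - σ t) e^{t cos + κ cos²}`. -/
def selfMap (κ σ t : ℝ) : ℝ :=
  ∫ x : Torus, (cosT x - σ * t) * (Real.exp (t * cosT x) * Real.exp (κ * cosT x ^ 2))

theorem integral_pi_sub (f : Torus → ℝ) : ∫ x, f ((π : ℝ) - x) = ∫ x, f x :=
  integral_sub_left_eq_self f volume _

theorem cosT_pi_sub (x : Torus) : cosT ((π : ℝ) - x) = -cosT x := by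
  rw [cosT_sub, cosT_pi, sinT_pi]; ring

theorem sinT_pi_sub (x : Torus) : sinT ((π : ℝ) - x) = sinT x := by
  rw [sinT_sub, cosT_pi, sinT_pi]; ring

theorem selfMap_neg (κ σ t : ℝ) : selfMap κ σ (-t) = -selfMap κ σ t := by
  rw [selfMap, ← integral_pi_sub, selfMap, ← integral_neg]
  congr 1; ext x
  rw [cosT_pi_sub]
  have h1 : -t * -cosT x = t * cosT x := by ring
  rw [h1, neg_sq]; ring

/-- The reflection `x ↦ π - x` reverses `cos`, so only the even part of the integrand in `cos`
contributes. -/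
theorem selfMap_eq (κ σ t : ℝ) : selfMap κ σ t =
    (∫ x : Torus, cosT x * Real.sinh (t * cosT x) * Real.exp (κ * cosT x ^ 2)) -
      σ * t * ∫ x : Torus, Real.cosh (t * cosT x) * Real.exp (κ * cosT x ^ 2) := by
  have h := selfMap_neg κ σ t
  have i1 : ∀ t, Integrable fun x : Torus =>
      (cosT x - σ * t) * (Real.exp (t * cosT x) * Real.exp (κ * cosT x ^ 2)) := fun t =>
    integrable_of_continuous_torus (by fun_prop)
  have h2 : selfMap κ σ t - selfMap κ σ (-t) = 2 * selfMap κ σ t := by rw [h]; ring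
  have h3 : selfMap κ σ t - selfMap κ σ (-t) = 2 *
      ((∫ x : Torus, cosT x * Real.sinh (t * cosT x) * Real.exp (κ * cosT x ^ 2)) -
      σ * t * ∫ x : Torus, Real.cosh (t * cosT x) * Real.exp (κ * cosT x ^ 2)) := by
    have j1 : Integrable fun x : Torus =>
        cosT x * Real.sinh (t * cosT x) * Real.exp (κ * cosT x ^ 2) :=
      integrable_of_continuous_torus (by fun_prop)
    have j2 : Integrable fun x : Torus =>
        σ * t * (Real.cosh (t * cosT x) * Real.exp (κ * cosT x ^ 2)) :=
      integrable_of_continuous_torus (by fun_prop)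
    rw [← integral_const_mul (σ * t), ← integral_sub j1 j2, ← integral_const_mul]
    rw [selfMap, selfMap, ← integral_sub (i1 t) (i1 (-t))]
    congr 1; ext x
    rw [Real.sinh_eq, Real.cosh_eq, neg_mul t]
    ring
  linarith

theorem hasSum_integral_cosh (κ t : ℝ) :
    HasSum (fun k : ℕ => t ^ (2 * k) / (2 * k).factorial * cosMoment κ k)
      (∫ x : Torus, Real.cosh (t * cosT x) * Real.exp (κ * cosT x ^ 2)) := by
  have h : ∀ k : ℕ, t ^ (2 * k) / (2 * k).factorial * cosMoment κ k =
      ∫ x : Torus, (t * cosT x) ^ (2 * k) / (2 * k).factorial * Real.exp (κ * cosT x ^ 2) := by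
    intro k
    rw [cosMoment, ← integral_const_mul]
    congr 1; ext x; rw [mul_pow]; ring
  simp only [h]
  refine hasSum_integral_of_dominated_convergence
    (fun k _ => |t| ^ (2 * k) / (2 * k).factorial * Real.exp |κ|) (fun k => ?_) (fun k => ?_) ?_ ?_ ?_
  · exact Continuous.aestronglyMeasurable (by fun_prop)
  · refine Filter.Eventually.of_forall fun x => ?_
    rw [norm_mul, norm_div, norm_pow, Real.norm_eq_abs, Real.norm_eq_abs, Real.norm_eq_abs,
      Real.abs_exp, Nat.abs_cast, abs_mul]
    gcongr
    · exact mul_le_of_le_one_right (abs_nonneg _) (abs_cosT_le_one x)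
    · calc κ * cosT x ^ 2 ≤ |κ| * cosT x ^ 2 := by gcongr; exact le_abs_self κ
        _ ≤ |κ| := mul_le_of_le_one_right (abs_nonneg _) (cosT_sq_le_one x)
  · exact Filter.Eventually.of_forall fun x => (Real.hasSum_cosh |t|).summable.mul_right _
  · exact integrable_const _
  · exact Filter.Eventually.of_forall fun x => (Real.hasSum_cosh (t * cosT x)).mul_right _

theorem hasSum_integral_sinh (κ t : ℝ) :
    HasSum (fun k : ℕ => t ^ (2 * k + 1) / (2 * k + 1).factorial * cosMoment κ (k + 1))
      (∫ x : Torus, cosT x * Real.sinh (t * cosT x) * Real.exp (κ * cosT x ^ 2)) := by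
  have h : ∀ k : ℕ, t ^ (2 * k + 1) / (2 * k + 1).factorial * cosMoment κ (k + 1) =
      ∫ x : Torus, cosT x * ((t * cosT x) ^ (2 * k + 1) / (2 * k + 1).factorial) *
        Real.exp (κ * cosT x ^ 2) := by
    intro k
    rw [cosMoment, ← integral_const_mul]
    congr 1; ext x; rw [mul_pow]; ring
  simp only [h]
  refine hasSum_integral_of_dominated_convergence
    (fun k _ => 1 * (|t| ^ (2 * k + 1) / (2 * k + 1).factorial) * Real.exp |κ|)
    (fun k => ?_) (fun k => ?_) ?_ ?_ ?_
  · exact Continuous.aestronglyMeasurable (by fun_prop)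
  · refine Filter.Eventually.of_forall fun x => ?_
    rw [norm_mul, norm_mul, norm_div, norm_pow, Real.norm_eq_abs, Real.norm_eq_abs,
      Real.norm_eq_abs, Real.norm_eq_abs, Real.abs_exp, Nat.abs_cast, abs_mul]
    gcongr
    · exact abs_cosT_le_one x
    · exact mul_le_of_le_one_right (abs_nonneg _) (abs_cosT_le_one x)
    · calc κ * cosT x ^ 2 ≤ |κ| * cosT x ^ 2 := by gcongr; exact le_abs_self κ
        _ ≤ |κ| := mul_le_of_le_one_right (abs_nonneg _) (cosT_sq_le_one x)
  · exact Filter.Eventually.of_forall fun x =>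
      ((Real.hasSum_sinh |t|).summable.mul_left 1).mul_right _
  · exact integrable_const _
  · exact Filter.Eventually.of_forall fun x =>
      ((Real.hasSum_sinh (t * cosT x)).mul_left _).mul_right _

/-- The sign-determining coefficients of the power series of `selfMap`. -/
def selfCoeff (κ σ : ℝ) (k : ℕ) : ℝ := cosMoment κ (k + 1) - (2 * k + 1) * σ * cosMoment κ k

/-- The factor `2k + 1` in `selfCoeff` comes from writing `t · t^{2k}/(2k)!` as `(2k+1)
t^{2k+1}/(2k+1)!`, which aligns the cosh series with the sinh series. -/
theorem hasSum_selfMap (κ σ t : ℝ) :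
    HasSum (fun k : ℕ => t ^ (2 * k + 1) / (2 * k + 1).factorial * selfCoeff κ σ k)
      (selfMap κ σ t) := by
  rw [selfMap_eq]
  have h := (hasSum_integral_sinh κ t).sub ((hasSum_integral_cosh κ t).mul_left (σ * t))
  refine h.congr_fun fun k => ?_
  rw [selfCoeff, Nat.factorial_succ]
  push_cast
  field_simp
  ring

/-! ### Roots of the self-consistency function -/

theorem selfMap_neg_of_selfCoeff_nonpos {κ σ t : ℝ} (ht : 0 < t)
    (h : ∀ k, selfCoeff κ σ k ≤ 0) {j : ℕ} (hj : selfCoeff κ σ j < 0) : selfMap κ σ t < 0 := by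
  refine hasSum_lt (f := fun k : ℕ => t ^ (2 * k + 1) / (2 * k + 1).factorial * selfCoeff κ σ k)
    (g := fun _ => 0) (i := j) (fun k => ?_) ?_ (hasSum_selfMap κ σ t) hasSum_zero
  · exact mul_nonpos_of_nonneg_of_nonpos (by positivity) (h k)
  · exact mul_neg_of_pos_of_neg (by positivity) hj

theorem eq_zero_of_selfMap_eq_zero {κ σ t : ℝ} (h : ∀ k, selfCoeff κ σ k ≤ 0) {j : ℕ}
    (hj : selfCoeff κ σ j < 0) (ht : selfMap κ σ t = 0) : t = 0 := by
  rcases lt_trichotomy t 0 with h0 | h0 | h0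
  · have h1 := selfMap_neg_of_selfCoeff_nonpos (neg_pos.mpr h0) h hj
    rw [selfMap_neg, ht] at h1
    simp at h1
  · exact h0
  · have h1 := selfMap_neg_of_selfCoeff_nonpos h0 h hj
    rw [ht] at h1
    simp at h1

/-- The moments decrease in `k`. Since the hypothesis holds for all large `k`, this starts the
descending induction and shows that the sign change does occur. -/
theorem selfCoeff_neg_of_one_lt {κ σ : ℝ} {k : ℕ} (h : 1 < (2 * k + 1) * σ) :
    selfCoeff κ σ k < 0 := by
  have h1 := cosMoment_succ_le κ k
  have h2 := cosMoment_pos κ k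
  rw [selfCoeff]
  nlinarith

theorem exists_one_lt_mul {σ : ℝ} (hσ : 0 < σ) : ∃ N : ℕ, ∀ k ≥ N, 1 < (2 * k + 1) * σ := by
  obtain ⟨N, hN⟩ := exists_nat_gt σ⁻¹
  refine ⟨N, fun k hk => ?_⟩
  have hk' : (N : ℝ) ≤ k := by exact_mod_cast hk
  have h1 : 1 < N * σ := by rwa [← div_lt_iff₀ hσ, one_div]
  nlinarith

/-- For the repulsive weight, all coefficients are nonpositive. -/
theorem selfCoeff_nonpos_of_repulsive {σ : ℝ} (hσ : 0 < σ) (k : ℕ) :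
    selfCoeff (-(2 / σ)) σ k ≤ 0 := by
  obtain ⟨N, hN⟩ := exists_one_lt_mul hσ
  -- Descending induction on `k`: `n` bounds the distance to the range `k ≥ N` where the
  -- coefficients are already negative.
  suffices H : ∀ n k : ℕ, N ≤ k + n → selfCoeff (-(2 / σ)) σ k ≤ 0 from H N k (Nat.le_add_left N k)
  intro n
  induction n with
  | zero => exact fun k hk => (selfCoeff_neg_of_one_lt (hN k hk)).le
  | succ n ih =>
    intro k hk
    have ih' := ih (k + 1) (by omega)
    have hrec : ∀ k : ℕ, σ * (2 * k + 2) * cosMoment (-(2 / σ)) (k + 1) +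
        4 * (cosMoment (-(2 / σ)) (k + 1) - cosMoment (-(2 / σ)) (k + 2)) =
        σ * (2 * k + 1) * cosMoment (-(2 / σ)) k := by
      intro k
      have := cosMoment_recurrence (-(2 / σ)) k
      field_simp at this
      linarith
    have r0 := hrec k
    have r1 := hrec (k + 1)
    have p1 := cosMoment_pos (-(2 / σ)) (k + 1)
    have l1 := cosMoment_succ_le (-(2 / σ)) (k + 1)
    have l2 := cosMoment_succ_le (-(2 / σ)) (k + 2)
    rw [selfCoeff] at ih' ⊢
    push_cast at ih' r1
    set m0 := cosMoment (-(2 / σ)) k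
    set m1 := cosMoment (-(2 / σ)) (k + 1)
    set m2 := cosMoment (-(2 / σ)) (k + 2)
    set m3 := cosMoment (-(2 / σ)) (k + 3)
    have hk0 : (0 : ℝ) ≤ k := Nat.cast_nonneg k
    set κ : ℝ := (k : ℝ)
    -- From the recurrence at `k + 1`, dropping `m2 - m3 ≥ 0`. Here `κ` is the index `k` as a real
    -- number, not the exponent of the weight.
    have hratio : (2 * κ + 4) * m2 ≤ (2 * κ + 3) * m1 := by
      have : σ * ((2 * κ + 4) * m2) ≤ σ * ((2 * κ + 3) * m1) := by linarith
      exact le_of_mul_le_mul_left this hσ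
    -- The goal after `m0` is eliminated through the recurrence at `k`. Three bounds on `m2 / m1`
    -- cover all `σ`: `m2 ≤ m1` for large `σ`, the induction hypothesis for small `σ`, and `hratio`
    -- in between.
    suffices hs : 4 * m2 ≤ (3 + (2 * κ + 2) * σ) * m1 by nlinarith
    rcases le_or_gt 1 ((2 * κ + 2) * σ) with ht | ht
    · nlinarith
    rcases le_or_gt ((2 * κ + 3) * σ * 4) (3 + (2 * κ + 2) * σ) with hc | hc
    · nlinarith
    · have h1 : (2 * κ + 3) * 4 ≤ (3 + (2 * κ + 2) * σ) * (2 * κ + 4) := by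
        nlinarith
      have h2 : (2 * κ + 4) * (4 * m2) ≤ (2 * κ + 4) * ((3 + (2 * κ + 2) * σ) * m1) := by
        nlinarith
      exact le_of_mul_le_mul_left h2 (by positivity)

theorem cosMoment_recurrence_attractive {σ : ℝ} (hσ : 0 < σ) (k : ℕ) :
    σ * (2 * k + 2) * cosMoment (2 / σ) (k + 1) -
      4 * (cosMoment (2 / σ) (k + 1) - cosMoment (2 / σ) (k + 2)) =
      σ * (2 * k + 1) * cosMoment (2 / σ) k := by
  have := cosMoment_recurrence (2 / σ) k
  field_simp at this
  linarith

/-- For the attractive weight, the coefficients change sign at most once. -/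
theorem selfCoeff_succ_neg_of_attractive {σ : ℝ} (hσ : 0 < σ) {k : ℕ}
    (h : selfCoeff (2 / σ) σ k ≤ 0) : selfCoeff (2 / σ) σ (k + 1) < 0 := by
  have r0 := cosMoment_recurrence_attractive hσ k
  have r1 := cosMoment_recurrence_attractive hσ (k + 1)
  have p1 := cosMoment_pos (2 / σ) (k + 1)
  have p2 := cosMoment_pos (2 / σ) (k + 2)
  have cs := cosMoment_sq_le (2 / σ) (k + 1)
  rw [selfCoeff] at h ⊢
  push_cast at r1 ⊢
  simp only [add_assoc] at *
  norm_num at *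
  set m0 := cosMoment (2 / σ) k
  set m1 := cosMoment (2 / σ) (k + 1)
  set m2 := cosMoment (2 / σ) (k + 2)
  set m3 := cosMoment (2 / σ) (k + 3)
  -- Eliminating `m0` by the recurrence at `k` turns the hypothesis into `h1`; eliminating `m1` from
  -- the goal by the recurrence at `k + 1` turns it into `h2`, of the same shape one index later.
  have h1 : 5 * m1 ≤ σ * (2 * k + 2) * m1 + 4 * m2 := by linarith
  have h2 : 5 * m2 < σ * (2 * k + 4) * m2 + 4 * m3 := by
    -- Multiply `h1` by `m2` and use `m2² ≤ m1 m3`. The spare term `2 σ m1 m2` gives strictness.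
    have h3 : 0 < m1 * (σ * (2 * k + 4) * m2 + 4 * m3 - 5 * m2) := by
      have := mul_le_mul_of_nonneg_right h1 p2.le
      have : 0 < σ * (m1 * m2) := by positivity
      nlinarith
    have := (mul_pos_iff_of_pos_left p1).mp h3
    linarith
  linarith

theorem selfCoeff_neg_of_lt {σ : ℝ} (hσ : 0 < σ) {N k : ℕ} (hN : selfCoeff (2 / σ) σ N ≤ 0)
    (hk : N < k) : selfCoeff (2 / σ) σ k < 0 := by
  induction k, hk using Nat.le_induction with
  | base => exact selfCoeff_succ_neg_of_attractive hσ hN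
  | succ n _ ih => exact selfCoeff_succ_neg_of_attractive hσ ih.le

theorem pow_mul_pow_lt {s t : ℝ} (hs : 0 < s) (hst : s < t) {p q : ℕ} (h : p < q) :
    s ^ q * t ^ p < t ^ q * s ^ p := by
  obtain ⟨d, rfl⟩ := Nat.exists_eq_add_of_lt h
  have h1 : s ^ (d + 1) < t ^ (d + 1) := pow_lt_pow_left₀ hst hs.le (by omega)
  have h2 : 0 < s ^ p * t ^ p := by have := hs.trans hst; positivity
  have h3 := mul_lt_mul_of_pos_left h1 h2
  calc s ^ (p + d + 1) * t ^ p = s ^ p * t ^ p * s ^ (d + 1) := by ring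
    _ < _ := h3
    _ = _ := by ring

/-- Descartes' rule of signs for a power series. Let `N` be the first index with a nonpositive
coefficient. The combination `s^{2N+1} selfMap(t) - t^{2N+1} selfMap(s)` loses its `N`-th term. For
`k < N` the coefficient is positive and the power factor negative; for `k > N` it is the reverse. So
the sum is negative, yet it vanishes at two roots. -/
theorem selfMap_roots_not_lt {σ s t : ℝ} (hσ : 0 < σ) (hs : 0 < s) (hst : s < t)
    (h1 : selfMap (2 / σ) σ s = 0) (h2 : selfMap (2 / σ) σ t = 0) : False := by
  classical
  obtain ⟨M, hM⟩ := exists_one_lt_mul hσ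
  have hex : ∃ k, selfCoeff (2 / σ) σ k ≤ 0 := ⟨M, (selfCoeff_neg_of_one_lt (hM M le_rfl)).le⟩
  set N := Nat.find hex with hN
  have hNle : selfCoeff (2 / σ) σ N ≤ 0 := Nat.find_spec hex
  have hlt : ∀ k < N, 0 < selfCoeff (2 / σ) σ k := fun k hk => not_le.mp (Nat.find_min hex hk)
  have hgt : ∀ k, N < k → selfCoeff (2 / σ) σ k < 0 := fun k hk => selfCoeff_neg_of_lt hσ hNle hk
  have hsum := ((hasSum_selfMap (2 / σ) σ t).mul_left (s ^ (2 * N + 1))).sub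
    ((hasSum_selfMap (2 / σ) σ s).mul_left (t ^ (2 * N + 1)))
  rw [h1, h2, mul_zero, mul_zero, sub_zero] at hsum
  have hform : ∀ k : ℕ, s ^ (2 * N + 1) * (t ^ (2 * k + 1) / (2 * k + 1).factorial *
      selfCoeff (2 / σ) σ k) - t ^ (2 * N + 1) * (s ^ (2 * k + 1) / (2 * k + 1).factorial *
      selfCoeff (2 / σ) σ k) = (s ^ (2 * N + 1) * t ^ (2 * k + 1) -
      t ^ (2 * N + 1) * s ^ (2 * k + 1)) / (2 * k + 1).factorial * selfCoeff (2 / σ) σ k := by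
    intro k; ring
  simp only [hform] at hsum
  have hneg : ∀ k, N < k → (s ^ (2 * N + 1) * t ^ (2 * k + 1) -
      t ^ (2 * N + 1) * s ^ (2 * k + 1)) / (2 * k + 1).factorial * selfCoeff (2 / σ) σ k < 0 := by
    intro k hk
    have := pow_mul_pow_lt hs hst (show 2 * N + 1 < 2 * k + 1 by omega)
    refine mul_neg_of_pos_of_neg (div_pos ?_ (by positivity)) (hgt k hk)
    linarith
  -- Strictness is taken at `N + 1`, since the term at `N` is zero and there may be none below it.
  refine lt_irrefl (0 : ℝ) (hasSum_lt (i := N + 1) (fun k => ?_) (hneg (N + 1) (by omega)) hsum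
    hasSum_zero)
  rcases lt_trichotomy k N with hk | hk | hk
  · have := pow_mul_pow_lt hs hst (show 2 * k + 1 < 2 * N + 1 by omega)
    refine mul_nonpos_of_nonpos_of_nonneg (div_nonpos_of_nonpos_of_nonneg ?_ (by positivity))
      (hlt k hk).le
    linarith
  · rw [hk]
    have : s ^ (2 * N + 1) * t ^ (2 * N + 1) - t ^ (2 * N + 1) * s ^ (2 * N + 1) = 0 := by ring
    rw [this]; simp
  · exact (hneg k hk).le

theorem selfMap_root_unique {σ s t : ℝ} (hσ : 0 < σ) (hs : 0 < s) (ht : 0 < t)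
    (h1 : selfMap (2 / σ) σ s = 0) (h2 : selfMap (2 / σ) σ t = 0) : s = t := by
  rcases lt_trichotomy s t with h | h | h
  · exact (selfMap_roots_not_lt hσ hs h h1 h2).elim
  · exact h
  · exact (selfMap_roots_not_lt hσ ht h h2 h1).elim

theorem continuous_selfMap (κ σ : ℝ) : Continuous (selfMap κ σ) :=
  continuous_integral_torus
    (f := fun t x => (cosT x - σ * t) * (Real.exp (t * cosT x) * Real.exp (κ * cosT x ^ 2)))
    (by unfold Function.uncurry; fun_prop)

/-- At `t = 1/σ` the factor `cos - σ t` becomes `cos - 1 ≤ 0`. This supplies the right endpoint for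
the intermediate value theorem. -/
theorem selfMap_inv_neg {κ σ : ℝ} (hσ : 0 < σ) : selfMap κ σ σ⁻¹ < 0 := by
  have h : 0 < ∫ x : Torus, (1 - cosT x) * (Real.exp (σ⁻¹ * cosT x) *
      Real.exp (κ * cosT x ^ 2)) := by
    refine integral_torus_pos (by fun_prop) (fun x => ?_) ((π / 2 : ℝ) : Torus) ?_
    · have := le_of_abs_le (abs_cosT_le_one x)
      exact mul_nonneg (by linarith) (by positivity)
    · rw [cosT_half_pi]; simp
  have h2 : selfMap κ σ σ⁻¹ = -∫ x : Torus, (1 - cosT x) * (Real.exp (σ⁻¹ * cosT x) *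
      Real.exp (κ * cosT x ^ 2)) := by
    rw [selfMap, ← integral_neg, mul_inv_cancel₀ hσ.ne']
    congr 1; ext x; ring
  linarith

theorem mul_sinh_mul_ge {t : ℝ} (ht : 0 ≤ t) (c : ℝ) : t * c ^ 2 ≤ c * Real.sinh (t * c) := by
  rcases le_total 0 c with h | h
  · have := Real.self_le_sinh_iff.mpr (mul_nonneg ht h)
    nlinarith
  · have := Real.self_le_sinh_iff.mpr (mul_nonneg ht (neg_nonneg.mpr h))
    rw [mul_neg, Real.sinh_neg] at this
    nlinarith

/-- From `c sinh(tc) ≥ t c²` and `cosh(tc) ≤ cosh t` for `|c| ≤ 1`. As `t → 0` the bracket tends to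
`selfCoeff κ σ 0`, so a positive leading coefficient gives positive values near `0` without
differentiation. -/
theorem selfMap_ge {κ σ t : ℝ} (hσ : 0 < σ) (ht : 0 ≤ t) :
    t * (cosMoment κ 1 - σ * Real.cosh t * cosMoment κ 0) ≤ selfMap κ σ t := by
  rw [selfMap_eq]
  have h1 : t * cosMoment κ 1 ≤
      ∫ x : Torus, cosT x * Real.sinh (t * cosT x) * Real.exp (κ * cosT x ^ 2) := by
    rw [cosMoment, ← integral_const_mul]
    refine integral_mono ((integrable_cosMoment κ 1).const_mul t)
      (integrable_of_continuous_torus (by fun_prop)) fun x => ?_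
    have := mul_le_mul_of_nonneg_right (mul_sinh_mul_ge ht (cosT x))
      (Real.exp_pos (κ * cosT x ^ 2)).le
    simpa [mul_assoc] using this
  have h2 : ∫ x : Torus, Real.cosh (t * cosT x) * Real.exp (κ * cosT x ^ 2) ≤
      Real.cosh t * cosMoment κ 0 := by
    rw [cosMoment, ← integral_const_mul]
    refine integral_mono (integrable_of_continuous_torus (by fun_prop))
      ((integrable_cosMoment κ 0).const_mul _) fun x => ?_
    have : Real.cosh (t * cosT x) ≤ Real.cosh t := by
      rw [Real.cosh_le_cosh, abs_mul]
      exact mul_le_of_le_one_right (abs_nonneg _) (abs_cosT_le_one x)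
    simpa using mul_le_mul_of_nonneg_right this (Real.exp_pos (κ * cosT x ^ 2)).le
  have h3 := mul_le_mul_of_nonneg_left h2 (mul_nonneg hσ.le ht)
  linarith

theorem exists_selfMap_root {κ σ : ℝ} (hσ : 0 < σ) (h : 0 < selfCoeff κ σ 0) :
    ∃ t, 0 < t ∧ selfMap κ σ t = 0 := by
  rw [selfCoeff] at h
  have hc : Continuous fun t => cosMoment κ 1 - σ * Real.cosh t * cosMoment κ 0 := by
    fun_prop
  have hev : ∀ᶠ t in nhds (0 : ℝ), 0 < cosMoment κ 1 - σ * Real.cosh t * cosMoment κ 0 :=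
    hc.continuousAt.eventually_const_lt (by simpa using h)
  obtain ⟨ε, hε, hball⟩ := Metric.eventually_nhds_iff.mp hev
  set s := min (ε / 2) σ⁻¹ with hs
  have hs0 : 0 < s := lt_min (by linarith) (inv_pos.mpr hσ)
  have hsε : s < ε := (min_le_left _ _).trans_lt (by linarith)
  have hpos : 0 < selfMap κ σ s :=
    (mul_pos hs0 (hball (by rwa [Real.dist_eq, sub_zero, abs_of_pos hs0]))).trans_le
      (selfMap_ge hσ hs0.le)
  obtain ⟨t, ht, ht0⟩ := intermediate_value_Icc' (min_le_right _ _ : s ≤ σ⁻¹)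
    (continuous_selfMap κ σ).continuousOn ⟨(selfMap_inv_neg hσ).le, hpos.le⟩
  exact ⟨t, hs0.trans_le ht.1, ht0⟩

/-! ### The critical noise level -/

/-- The ratio of consecutive even moments under `e^{2 cos² / σ}`; for `k = 0` it is the mean of
`cos²`, equivalently of `sin²` under `ρ_{0,0}`. -/
def momentRatio (σ : ℝ) (k : ℕ) : ℝ := cosMoment (2 / σ) (k + 1) / cosMoment (2 / σ) k

theorem momentRatio_pos (σ : ℝ) (k : ℕ) : 0 < momentRatio σ k :=
  div_pos (cosMoment_pos _ _) (cosMoment_pos _ _)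

theorem momentRatio_le_one (σ : ℝ) (k : ℕ) : momentRatio σ k ≤ 1 :=
  (div_le_one (cosMoment_pos _ _)).mpr (cosMoment_succ_le _ _)

/-- Solved for the ratio at `k`, this is one level of a continued fraction, decreasing in the ratio
at `k + 1`. Upper and lower bounds therefore alternate on the way down to `k = 0`. -/
theorem momentRatio_recurrence {σ : ℝ} (hσ : 0 < σ) (k : ℕ) :
    momentRatio σ k * (σ * (2 * k + 2) - 4 + 4 * momentRatio σ (k + 1)) = σ * (2 * k + 1) := by
  have h := cosMoment_recurrence_attractive hσ k
  have h0 := (cosMoment_pos (2 / σ) k).ne'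
  have h1 := (cosMoment_pos (2 / σ) (k + 1)).ne'
  rw [momentRatio, momentRatio]
  field_simp
  rw [add_assoc k 1 1, one_add_one_eq_two]
  linarith

theorem momentRatio_le {σ : ℝ} (hσ : 0 < σ) (k : ℕ) {l u : ℝ} (hl : l ≤ momentRatio σ (k + 1))
    (hu : σ * (2 * k + 1) ≤ u * (σ * (2 * k + 2) - 4 + 4 * l))
    (hpos : 0 < σ * (2 * k + 2) - 4 + 4 * l) : momentRatio σ k ≤ u := by
  have h := momentRatio_recurrence hσ k
  have h0 := momentRatio_pos σ k
  refine le_of_mul_le_mul_right (le_trans ?_ hu) hpos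
  nlinarith

theorem le_momentRatio {σ : ℝ} (hσ : 0 < σ) (k : ℕ) {l u : ℝ} (hu : momentRatio σ (k + 1) ≤ u)
    (hl : l * (σ * (2 * k + 2) - 4 + 4 * u) ≤ σ * (2 * k + 1))
    (hpos : 0 < σ * (2 * k + 2) - 4 + 4 * u) : l ≤ momentRatio σ k := by
  have h := momentRatio_recurrence hσ k
  have h0 := momentRatio_pos σ k
  refine le_of_mul_le_mul_right (hl.trans ?_) hpos
  nlinarith

theorem le_momentRatio_at_lower : 0.77085 ≤ momentRatio 0.77085 0 := by
  have hσ : (0 : ℝ) < 0.77085 := by norm_num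
  -- The trivial bound `1` at index 11 starts the descent; its parity makes the bound at index 0 a
  -- lower one. Each decimal is rounded in the safe direction.
  have h10 : 0.95454545 ≤ momentRatio 0.77085 10 :=
    le_momentRatio hσ 10 (momentRatio_le_one 0.77085 11) (by norm_num) (by norm_num)
  have h9 : momentRatio 0.77085 9 ≤ 0.9613374 :=
    momentRatio_le hσ 9 h10 (by norm_num) (by norm_num)
  have h8 : 0.95508961 ≤ momentRatio 0.77085 8 :=
    le_momentRatio hσ 8 h9 (by norm_num) (by norm_num)
  have h7 : momentRatio 0.77085 7 ≤ 0.95135672 :=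
    momentRatio_le hσ 7 h8 (by norm_num) (by norm_num)
  have h6 : 0.94562054 ≤ momentRatio 0.77085 6 :=
    le_momentRatio hσ 6 h7 (by norm_num) (by norm_num)
  have h5 : momentRatio 0.77085 5 ≤ 0.93874111 :=
    momentRatio_le hσ 5 h6 (by norm_num) (by norm_num)
  have h4 : 0.9295482 ≤ momentRatio 0.77085 4 :=
    le_momentRatio hσ 4 h5 (by norm_num) (by norm_num)
  have h3 : momentRatio 0.77085 3 ≤ 0.91690002 :=
    momentRatio_le hσ 3 h4 (by norm_num) (by norm_num)
  have h2 : 0.89786146 ≤ momentRatio 0.77085 2 :=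
    le_momentRatio hσ 2 h3 (by norm_num) (by norm_num)
  have h1 : momentRatio 0.77085 1 ≤ 0.8645545 :=
    momentRatio_le hσ 1 h2 (by norm_num) (by norm_num)
  exact le_momentRatio hσ 0 h1 (by norm_num) (by norm_num)

theorem momentRatio_le_at_upper : momentRatio 0.77095 0 ≤ 0.77095 := by
  have hσ : (0 : ℝ) < 0.77095 := by norm_num
  -- One level more than at the other endpoint, so that the descent ends with an upper bound.
  have h11 : 0.95833333 ≤ momentRatio 0.77095 11 :=
    le_momentRatio hσ 11 (momentRatio_le_one 0.77095 12) (by norm_num) (by norm_num)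
  have h10 : momentRatio 0.77095 10 ≤ 0.96401841 :=
    momentRatio_le hσ 10 h11 (by norm_num) (by norm_num)
  have h9 : 0.95895118 ≤ momentRatio 0.77095 9 :=
    le_momentRatio hσ 9 h10 (by norm_num) (by norm_num)
  have h8 : momentRatio 0.77095 8 ≤ 0.95575302 :=
    momentRatio_le hσ 8 h9 (by norm_num) (by norm_num)
  have h7 : 0.95114725 ≤ momentRatio 0.77095 7 :=
    le_momentRatio hσ 7 h8 (by norm_num) (by norm_num)
  have h6 : momentRatio 0.77095 6 ≤ 0.94569306 :=
    momentRatio_le hσ 6 h7 (by norm_num) (by norm_num)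
  have h5 : 0.93870802 ≤ momentRatio 0.77095 5 :=
    le_momentRatio hσ 5 h6 (by norm_num) (by norm_num)
  have h4 : momentRatio 0.77095 4 ≤ 0.92956074 :=
    momentRatio_le hσ 4 h5 (by norm_num) (by norm_num)
  have h3 : 0.9168865 ≤ momentRatio 0.77095 3 :=
    le_momentRatio hσ 3 h4 (by norm_num) (by norm_num)
  have h2 : momentRatio 0.77095 2 ≤ 0.89786377 :=
    momentRatio_le hσ 2 h3 (by norm_num) (by norm_num)
  have h1 : 0.86453438 ≤ momentRatio 0.77095 1 :=
    le_momentRatio hσ 1 h2 (by norm_num) (by norm_num)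
  exact momentRatio_le hσ 0 h1 (by norm_num) (by norm_num)

/-- A larger `σ` weakens the tilt `e^{2 cos²/σ}`. Since the ratio decreases while `σ` increases,
they cross at most once. -/
theorem momentRatio_anti {σ τ : ℝ} (hσ : 0 < σ) (h : σ ≤ τ) :
    momentRatio τ 0 ≤ momentRatio σ 0 := by
  have h1 : 2 / τ ≤ 2 / σ := by gcongr
  rw [momentRatio, momentRatio, div_le_div_iff₀ (cosMoment_pos _ _) (cosMoment_pos _ _)]
  exact cosMoment_ratio_mono h1

theorem exists_momentRatio_eq : ∃ σ : ℝ, 0.77085 ≤ σ ∧ σ ≤ 0.77095 ∧ momentRatio σ 0 = σ := by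
  have hc : ContinuousOn (fun σ => momentRatio σ 0 - σ) (Set.Icc 0.77085 0.77095) := by
    have hκ : ContinuousOn (fun σ : ℝ => 2 / σ) (Set.Icc 0.77085 0.77095) :=
      continuousOn_const.div continuousOn_id fun x hx => by
        have h1 : (0.77085 : ℝ) ≤ x := hx.1
        have h2 : (0 : ℝ) < x := by linarith
        exact h2.ne'
    exact (((continuous_cosMoment 1).comp_continuousOn hκ).div
      ((continuous_cosMoment 0).comp_continuousOn hκ) fun x _ => (cosMoment_pos _ _).ne').sub
      continuousOn_id
  obtain ⟨σ, hσ, h⟩ := intermediate_value_Icc' (by norm_num) hc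
    (show (0 : ℝ) ∈ Set.Icc _ _ from
      ⟨sub_nonpos.mpr momentRatio_le_at_upper, sub_nonneg.mpr le_momentRatio_at_lower⟩)
  exact ⟨σ, hσ.1, hσ.2, sub_eq_zero.mp h⟩

theorem momentRatio_root_unique {σ τ : ℝ} (hσ : 0 < σ) (hτ : 0 < τ) (h1 : momentRatio σ 0 = σ)
    (h2 : momentRatio τ 0 = τ) : σ = τ := by
  rcases le_total σ τ with h | h
  · have := momentRatio_anti hσ h; linarith
  · have := momentRatio_anti hτ h; linarith

theorem besselI_zero_eq (z : ℝ) : besselI 0 z = Real.exp (-z) * cosMoment (2 * z) 0 := by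
  rw [besselI, cosMoment, ← integral_const_mul, integral_torus_eq]
  congr 1; ext t
  rw [cosT_coe, mul_left_comm, ← Real.exp_add, Real.cos_two_mul]
  have : -z + 2 * z * Real.cos t ^ 2 = z * (2 * Real.cos t ^ 2 - 1) := by ring
  rw [this]; simp

theorem besselI_one_eq (z : ℝ) : besselI 1 z =
    Real.exp (-z) * (2 * cosMoment (2 * z) 1 - cosMoment (2 * z) 0) := by
  rw [besselI, cosMoment, cosMoment, ← integral_const_mul, ← integral_sub
    ((integrable_cosMoment _ 1).const_mul 2) (integrable_cosMoment _ 0), ← integral_const_mul,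
    integral_torus_eq]
  congr 1; ext t
  have h : z * (2 * Real.cos t ^ 2 - 1) = -z + 2 * z * Real.cos t ^ 2 := by ring
  simp only [cosT_coe, Nat.cast_one, mul_one, Real.cos_two_mul, h, Real.exp_add]
  ring

/-- By `cos 2x = 2 cos² x - 1`, the Bessel quotient `r_0(1/σ)` equals `2 · momentRatio σ 0 - 1`. -/
theorem fCrit_eq {σ : ℝ} (hσ : 0 < σ) : fCrit σ = 2 / σ * (momentRatio σ 0 - σ) := by
  have h0 := (cosMoment_pos (2 / σ) 0).ne'
  have he : Real.exp (-(1 / σ)) ≠ 0 := (Real.exp_pos _).ne'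
  have h2 : 2 * (1 / σ) = 2 / σ := by ring
  rw [fCrit, besselR, zero_add, besselI_zero_eq, besselI_one_eq, h2,
    mul_div_mul_left _ _ he, momentRatio, zero_add]
  field_simp
  ring

theorem fCrit_eq_zero_iff {σ : ℝ} (hσ : 0 < σ) : fCrit σ = 0 ↔ momentRatio σ 0 = σ := by
  rw [fCrit_eq hσ, mul_eq_zero, sub_eq_zero]
  simp [hσ.ne']

theorem selfCoeff_zero (σ : ℝ) :
    selfCoeff (2 / σ) σ 0 = (momentRatio σ 0 - σ) * cosMoment (2 / σ) 0 := by
  have h0 := (cosMoment_pos (2 / σ) 0).ne'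
  rw [selfCoeff, momentRatio]
  field_simp
  simp

/-! ### Reduction to one parameter -/

/-- Since `-V = 1 - 2 cos² = -1 + 2 sin²`, the confinement penalises alignment with the cosine axis
and favours the sine axis: hence `κ = -2/σ` here and `κ = 2/σ` for `gibbsWeight_sin`. -/
theorem gibbsWeight_cos (σ a : ℝ) (x : Torus) : gibbsWeight σ a 0 x =
    Real.exp σ⁻¹ * (Real.exp (a / σ * cosT x) * Real.exp (-(2 / σ) * cosT x ^ 2)) := by
  rw [gibbsWeight, gibbsExponent, potentialV_eq, ← Real.exp_add, ← Real.exp_add]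
  congr 1; ring

theorem gibbsWeight_sin (σ b : ℝ) (x : Torus) : gibbsWeight σ 0 b x =
    Real.exp (-σ⁻¹) * (Real.exp (b / σ * sinT x) * Real.exp (2 / σ * sinT x ^ 2)) := by
  rw [gibbsWeight, gibbsExponent, potentialV_eq_sin, ← Real.exp_add, ← Real.exp_add]
  congr 1; ring

theorem gibbsWeight_pi_sub (σ a b : ℝ) (x : Torus) :
    gibbsWeight σ a b ((π : ℝ) - x) = gibbsWeight σ (-a) b x := by
  rw [gibbsWeight, gibbsWeight, gibbsExponent, gibbsExponent, potentialV_eq, potentialV_eq,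
    cosT_pi_sub, sinT_pi_sub]
  congr 1; ring

theorem gibbsWeight_neg (σ a b : ℝ) (x : Torus) :
    gibbsWeight σ a b (-x) = gibbsWeight σ a (-b) x := by
  rw [gibbsWeight, gibbsWeight, gibbsExponent, gibbsExponent, potentialV_eq, potentialV_eq,
    cosT_neg, sinT_neg]
  congr 1; ring

theorem selfMap_eq_zero_of_cos {σ a : ℝ} (hσ : 0 < σ) (h : IsSelfConsistent σ a 0) :
    selfMap (-(2 / σ)) σ (a / σ) = 0 := by
  have h1 := h.1
  have h2 : ∀ x, (cosT x - a) * gibbsWeight σ a 0 x = Real.exp σ⁻¹ * ((cosT x - σ * (a / σ)) *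
      (Real.exp (a / σ * cosT x) * Real.exp (-(2 / σ) * cosT x ^ 2))) := by
    intro x
    rw [gibbsWeight_cos, mul_div_cancel₀ _ hσ.ne']
    ring
  simp only [h2] at h1
  rw [integral_const_mul] at h1
  exact (mul_eq_zero.mp h1).resolve_left (Real.exp_pos _).ne'

/-- The cosine equation holds by the symmetry `x ↦ π - x`; in the sine equation `x ↦ π/2 - x` turns
`sin` into `cos`. -/
theorem isSelfConsistent_sin_iff {σ b : ℝ} (hσ : 0 < σ) :
    IsSelfConsistent σ 0 b ↔ selfMap (2 / σ) σ (b / σ) = 0 := by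
  have hcos : ∫ x, (cosT x - 0) * gibbsWeight σ 0 b x = 0 := by
    have h := integral_pi_sub fun x => (cosT x - 0) * gibbsWeight σ 0 b x
    simp only [gibbsWeight_pi_sub, cosT_pi_sub, sub_zero, neg_mul, neg_zero] at h ⊢
    rw [integral_neg] at h
    linarith
  have hsin : ∫ x, (sinT x - b) * gibbsWeight σ 0 b x =
      Real.exp (-σ⁻¹) * selfMap (2 / σ) σ (b / σ) := by
    rw [selfMap, ← integral_const_mul,
      ← integral_sub_left_eq_self _ volume ((π / 2 : ℝ) : Torus)]
    congr 1; ext x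
    have h1 : sinT ((π / 2 : ℝ) - x) = cosT x := by
      rw [sinT_sub, sinT_half_pi, cosT_half_pi]; ring
    rw [gibbsWeight_sin, h1, mul_div_cancel₀ _ hσ.ne']
    ring
  rw [IsSelfConsistent, hcos, hsin]
  simp

/-- At most one of the two components of the mean of a stationary solution is nonzero. -/
theorem IsSelfConsistent.mul_eq_zero {σ a b : ℝ} (hσ : 0 < σ) (h : IsSelfConsistent σ a b) :
    a * b = 0 := by
  have ic : Integrable fun x => cosT x * gibbsWeight σ a b x :=
    integrable_of_continuous_torus (by fun_prop)
  have is : Integrable fun x => sinT x * gibbsWeight σ a b x :=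
    integrable_of_continuous_torus (by fun_prop)
  have i1 : Integrable fun x => gibbsWeight σ a b x :=
    integrable_of_continuous_torus (by fun_prop)
  have isc : Integrable fun x => sinT x * cosT x * gibbsWeight σ a b x :=
    integrable_of_continuous_torus (by fun_prop)
  set J := ∫ x, sinT x * cosT x * gibbsWeight σ a b x with hJ
  have hc := h.1
  have hs := h.2
  simp only [sub_mul] at hc hs
  rw [integral_sub ic (i1.const_mul a), integral_const_mul] at hc
  rw [integral_sub is (i1.const_mul b), integral_const_mul] at hs
  -- The integral of the derivative of the weight is zero. Self-consistency makes its two linear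
  -- terms equal to `-a b` and `b a` times the same factor, so they cancel and leave `J`.
  have hJ0 : J = 0 := by
    have hd := integral_derivT (smoothT_gibbsWeight σ a b)
    have h1 : ∀ x, derivT (gibbsWeight σ a b) x =
        (4 * σ⁻¹) * (sinT x * cosT x * gibbsWeight σ a b x) +
        (-(σ⁻¹ * a)) * (sinT x * gibbsWeight σ a b x) +
        (σ⁻¹ * b) * (cosT x * gibbsWeight σ a b x) + 0 * gibbsWeight σ a b x := by
      intro x
      have h3 : derivT (gibbsWeight σ a b) x =
          gibbsWeight σ a b x * derivT (gibbsExponent σ a b) x :=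
        derivT_exp (smoothT_gibbsExponent σ a b) x
      rw [h3, derivT_gibbsExponent]
      ring
    simp only [h1] at hd
    rw [integral_linear_combination isc is ic i1] at hd
    have h4 : σ⁻¹ * (4 * J) = 0 := by
      linear_combination hd + σ⁻¹ * a * hs - σ⁻¹ * b * hc
    simpa [hσ.ne'] using h4
  set w : Torus → ℝ := fun x => Real.exp (-(σ⁻¹ * potentialV x)) with hw
  have hwc : Continuous w := by have := continuous_potentialV; fun_prop
  -- Averaging over the reflections `x ↦ -x`, `x ↦ π - x` and their composition replaces the
  -- exponentials by a product of two `sinh`. As `y sinh y ≥ 0`, a nonzero `a * b` would give `a b J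
  -- > 0`.
  have hfold : 4 * J = ∫ x, 4 * (sinT x * cosT x * (Real.sinh (a / σ * cosT x) *
      Real.sinh (b / σ * sinT x) * w x)) := by
    have hneg : ∀ a b : ℝ, ∫ x, sinT x * cosT x * gibbsWeight σ a (-b) x =
        -∫ x, sinT x * cosT x * gibbsWeight σ a b x := by
      intro a b
      rw [← integral_neg_eq_self (fun x => sinT x * cosT x * gibbsWeight σ a b x), ← integral_neg]
      congr 1; ext x
      rw [gibbsWeight_neg, cosT_neg, sinT_neg]; ring
    have hpi : ∀ a b : ℝ, ∫ x, sinT x * cosT x * gibbsWeight σ (-a) b x =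
        -∫ x, sinT x * cosT x * gibbsWeight σ a b x := by
      intro a b
      rw [← integral_pi_sub (fun x => sinT x * cosT x * gibbsWeight σ a b x), ← integral_neg]
      congr 1; ext x
      rw [gibbsWeight_pi_sub, cosT_pi_sub, sinT_pi_sub]; ring
    have hi : ∀ a b : ℝ, Integrable fun x => sinT x * cosT x * gibbsWeight σ a b x := fun a b =>
      integrable_of_continuous_torus (by fun_prop)
    have hsplit : ∀ x, 4 * (sinT x * cosT x * (Real.sinh (a / σ * cosT x) *
        Real.sinh (b / σ * sinT x) * w x)) =
        1 * (sinT x * cosT x * gibbsWeight σ a b x) +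
        (-1) * (sinT x * cosT x * gibbsWeight σ a (-b) x) +
        (-1) * (sinT x * cosT x * gibbsWeight σ (-a) b x) +
        1 * (sinT x * cosT x * gibbsWeight σ (-a) (-b) x) := by
      intro x
      have hg : ∀ a b : ℝ, gibbsWeight σ a b x =
          w x * Real.exp (a / σ * cosT x) * Real.exp (b / σ * sinT x) := by
        intro a b
        rw [gibbsWeight, gibbsExponent, hw, ← Real.exp_add, ← Real.exp_add]
        congr 1; ring
      simp only [hg, Real.sinh_eq, neg_div, neg_mul]
      ring
    simp only [hsplit]
    rw [integral_linear_combination (hi _ _) (hi _ _) (hi _ _) (hi _ _), hneg, hpi, hpi, hneg]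
    ring
  by_contra hab
  obtain ⟨ha, hb⟩ := mul_ne_zero_iff.mp hab
  have hsq : ∀ y : ℝ, 0 ≤ y * Real.sinh y := fun y => by
    have := mul_sinh_mul_ge zero_le_one y
    rw [one_mul, one_mul] at this
    exact (sq_nonneg y).trans this
  have hform : ∀ x, a * b * σ⁻¹ ^ 2 * (4 * (sinT x * cosT x * (Real.sinh (a / σ * cosT x) *
      Real.sinh (b / σ * sinT x) * w x))) = 4 * ((a / σ * cosT x) * Real.sinh (a / σ * cosT x)) *
      ((b / σ * sinT x) * Real.sinh (b / σ * sinT x)) * w x := by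
    intro x; ring
  have hpos : 0 < ∫ x, a * b * σ⁻¹ ^ 2 * (4 * (sinT x * cosT x *
      (Real.sinh (a / σ * cosT x) * Real.sinh (b / σ * sinT x) * w x))) := by
    -- At `π/4` neither `sin` nor `cos` vanishes.
    refine integral_torus_pos (by fun_prop) (fun x => ?_) ((π / 4 : ℝ) : Torus) ?_
    · rw [hform]
      have := hsq (a / σ * cosT x)
      have := hsq (b / σ * sinT x)
      have := (Real.exp_pos (-(σ⁻¹ * potentialV x))).le
      positivity
    · have h2 : √2 / 2 ≠ 0 := by positivity
      have hcp : cosT ((π / 4 : ℝ) : Torus) ≠ 0 := by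
        rw [cosT_coe, Real.cos_pi_div_four]; exact h2
      have hsp : sinT ((π / 4 : ℝ) : Torus) ≠ 0 := by
        rw [sinT_coe, Real.sin_pi_div_four]; exact h2
      have hwp : w ((π / 4 : ℝ) : Torus) ≠ 0 := (Real.exp_pos _).ne'
      simp [ha, hb, hσ.ne', hcp, hsp, hwp, Real.sinh_eq_zero]
  rw [integral_const_mul, ← hfold, hJ0] at hpos
  simp at hpos

theorem IsSelfConsistent.left_eq_zero {σ a b : ℝ} (hσ : 0 < σ) (h : IsSelfConsistent σ a b) :
    a = 0 := by
  rcases _root_.mul_eq_zero.mp (h.mul_eq_zero hσ) with h0 | h0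
  · exact h0
  · subst h0
    obtain ⟨N, hN⟩ := exists_one_lt_mul hσ
    have := eq_zero_of_selfMap_eq_zero (selfCoeff_nonpos_of_repulsive hσ)
      (selfCoeff_neg_of_one_lt (hN N le_rfl)) (selfMap_eq_zero_of_cos hσ h)
    simpa [hσ.ne'] using this

theorem mem_stationarySolutions_iff_selfMap {σ : ℝ} (hσ : 0 < σ) (ρ : L2T) :
    ρ ∈ stationarySolutions σ ↔
      ∃ t, selfMap (2 / σ) σ t = 0 ∧ ρ = toL2T (gibbsDensity σ 0 (σ * t)) := by
  rw [mem_stationarySolutions_iff hσ]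
  constructor
  · rintro ⟨a, b, h, rfl⟩
    obtain rfl := h.left_eq_zero hσ
    refine ⟨b / σ, (isSelfConsistent_sin_iff hσ).mp h, ?_⟩
    rw [mul_div_cancel₀ _ hσ.ne']
  · rintro ⟨t, h, rfl⟩
    refine ⟨0, σ * t, (isSelfConsistent_sin_iff hσ).mpr ?_, rfl⟩
    rwa [mul_div_cancel_left₀ _ hσ.ne']

theorem selfMap_zero (κ σ : ℝ) : selfMap κ σ 0 = 0 := by
  have h := selfMap_neg κ σ 0
  rw [neg_zero] at h
  linarith

theorem rhoZero_mem {σ : ℝ} (hσ : 0 < σ) : toL2T (rhoZero σ) ∈ stationarySolutions σ := by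
  rw [mem_stationarySolutions_iff_selfMap hσ, rhoZero_eq_gibbsDensity]
  exact ⟨0, selfMap_zero _ _, by rw [mul_zero]⟩

theorem stationarySolutions_eq_singleton {σ : ℝ} (hσ : 0 < σ) (h : momentRatio σ 0 ≤ σ) :
    stationarySolutions σ = {toL2T (rhoZero σ)} := by
  refine Set.eq_singleton_iff_unique_mem.mpr ⟨rhoZero_mem hσ, fun ρ hρ => ?_⟩
  obtain ⟨t, ht, rfl⟩ := (mem_stationarySolutions_iff_selfMap hσ ρ).mp hρ
  have h0 : selfCoeff (2 / σ) σ 0 ≤ 0 := by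
    rw [selfCoeff_zero]
    exact mul_nonpos_of_nonpos_of_nonneg (sub_nonpos.mpr h) (cosMoment_pos _ _).le
  have hall : ∀ k, selfCoeff (2 / σ) σ k ≤ 0 := fun k => by
    rcases Nat.eq_zero_or_pos k with rfl | hk
    · exact h0
    · exact (selfCoeff_neg_of_lt hσ h0 hk).le
  -- The strictly negative coefficient is taken at index 1, because the one at index 0 vanishes when
  -- `momentRatio σ 0 = σ`.
  rw [eq_zero_of_selfMap_eq_zero hall (selfCoeff_neg_of_lt hσ h0 zero_lt_one) ht, mul_zero,
    rhoZero_eq_gibbsDensity]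

/-! ### The two symmetry-broken solutions -/

theorem eq_of_sinT_eq_one {x : Torus} (h : sinT x = 1) : x = ((π / 2 : ℝ) : Torus) := by
  induction x using QuotientAddGroup.induction_on with
  | H t =>
    obtain ⟨k, hk⟩ := Real.sin_eq_one_iff.mp h
    have h0 : (((k : ℝ) * (2 * π) : ℝ) : Torus) = 0 := by
      rw [← zsmul_eq_mul, AddCircle.coe_zsmul, AddCircle.coe_period, smul_zero]
    change (t : Torus) = _
    rw [← hk, AddCircle.coe_add, h0, add_zero]

theorem sinT_le_one (x : Torus) : sinT x ≤ 1 := by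
  nlinarith [sinT_sq_add_cosT_sq x, sq_nonneg (cosT x), sq_nonneg (sinT x - 1)]

theorem neg_one_le_sinT (x : Torus) : -1 ≤ sinT x := by
  nlinarith [sinT_sq_add_cosT_sq x, sq_nonneg (cosT x), sq_nonneg (sinT x + 1)]

theorem centredAt_gibbsDensity {σ b : ℝ} (hσ : 0 < σ) (hb : 0 < b) (h : IsSelfConsistent σ 0 b) :
    CentredAt ((π / 2 : ℝ) : Torus) (gibbsDensity σ 0 b) := by
  have h' := (isSelfConsistent_iff σ 0 b).mp h
  have hc : ∀ x, cosT (x - ((π / 2 : ℝ) : Torus)) = sinT x := fun x => by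
    rw [cosT_sub, cosT_half_pi, sinT_half_pi]; ring
  have hs : ∀ x, sinT (x - ((π / 2 : ℝ) : Torus)) = -cosT x := fun x => by
    rw [sinT_sub, cosT_half_pi, sinT_half_pi]; ring
  have hZ := inv_pos.mpr (integral_gibbsWeight_pos σ 0 b)
  refine ⟨fun x => ?_, fun x hx => ?_, ?_, ?_⟩
  · have h1 : sinT ((π / 2 : ℝ) + x) = sinT ((π / 2 : ℝ) - x) := by
      rw [sinT_add, sinT_sub, cosT_half_pi]; ring
    rw [gibbsDensity_apply, gibbsDensity_apply, gibbsWeight_sin, gibbsWeight_sin, h1]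
  · have hlt : sinT x < 1 := (sinT_le_one x).lt_of_ne fun h1 => hx (eq_of_sinT_eq_one h1)
    have hge := neg_one_le_sinT x
    rw [gibbsDensity_apply, gibbsDensity_apply, gibbsWeight_sin, gibbsWeight_sin, sinT_half_pi]
    refine mul_lt_mul_of_pos_left (mul_lt_mul_of_pos_left ?_ (Real.exp_pos _)) hZ
    refine mul_lt_mul (Real.exp_lt_exp.mpr ?_) (Real.exp_le_exp.mpr ?_) (Real.exp_pos _)
      (Real.exp_pos _).le
    · exact mul_lt_mul_of_pos_left hlt (div_pos hb hσ)
    · refine mul_le_mul_of_nonneg_left ?_ (by positivity)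
      nlinarith
  · simp only [hc]
    rw [h'.2]
    exact hb
  · simp only [hs, neg_mul]
    rw [integral_neg, h'.1, neg_zero]

theorem CentredAt.comp_neg {c : Torus} {f : Torus → ℝ} (h : CentredAt c f) :
    CentredAt (-c) fun x => f (-x) := by
  obtain ⟨h1, h2, h3, h4⟩ := h
  refine ⟨fun x => ?_, fun x hx => ?_, ?_, ?_⟩
  · have e1 : -(-c + x) = c - x := by abel
    have e2 : -(-c - x) = c + x := by abel
    simp only [e1, e2, h1 x]
  · simp only [neg_neg]
    exact h2 _ fun h => hx (by rw [← h, neg_neg])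
  · rw [← integral_neg_eq_self (fun x => cosT (x - -c) * f (-x))]
    refine h3.trans_eq (integral_congr_ae (Filter.Eventually.of_forall fun x => ?_))
    have e : -x - -c = -(x - c) := by abel
    simp only [e, cosT_neg, neg_neg]
  · rw [← integral_neg_eq_self (fun x => sinT (x - -c) * f (-x)), ← neg_eq_zero, ← integral_neg,
      ← h4]
    refine integral_congr_ae (Filter.Eventually.of_forall fun x => ?_)
    have e : -x - -c = -(x - c) := by abel
    simp only [e, sinT_neg, neg_neg, neg_mul]

theorem gibbsDensity_neg (σ b : ℝ) (x : Torus) :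
    gibbsDensity σ 0 b (-x) = gibbsDensity σ 0 (-b) x := by
  have h : ∫ y, gibbsWeight σ 0 (-b) y = ∫ y, gibbsWeight σ 0 b y := by
    simp only [← gibbsWeight_neg]
    exact integral_neg_eq_self _ _
  rw [gibbsDensity_apply, gibbsDensity_apply, gibbsWeight_neg, h]

theorem threeStationarySolutions {σ : ℝ} (hσ : 0 < σ) (h : σ < momentRatio σ 0) :
    ThreeStationarySolutions σ := by
  have h0 : 0 < selfCoeff (2 / σ) σ 0 := by
    rw [selfCoeff_zero]
    exact mul_pos (sub_pos.mpr h) (cosMoment_pos _ _)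
  obtain ⟨t, ht, hroot⟩ := exists_selfMap_root hσ h0
  set b := σ * t with hb
  have hb0 : 0 < b := mul_pos hσ ht
  have hsc : IsSelfConsistent σ 0 b := by
    rw [isSelfConsistent_sin_iff hσ, hb, mul_div_cancel_left₀ _ hσ.ne']
    exact hroot
  have hscn : IsSelfConsistent σ 0 (-b) := by
    rw [isSelfConsistent_sin_iff hσ, neg_div, selfMap_neg, hb, mul_div_cancel_left₀ _ hσ.ne',
      hroot, neg_zero]
  have hsc0 : IsSelfConsistent σ 0 0 := by
    rw [isSelfConsistent_sin_iff hσ, zero_div, selfMap_zero]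
  -- The parameter is recovered from the density as its sine moment.
  have hinj : ∀ {b c : ℝ}, IsSelfConsistent σ 0 b → IsSelfConsistent σ 0 c →
      toL2T (gibbsDensity σ 0 b) = toL2T (gibbsDensity σ 0 c) → b = c := by
    intro b c h1 h2 he
    rw [← ((isSelfConsistent_iff σ 0 b).mp h1).2, ← ((isSelfConsistent_iff σ 0 c).mp h2).2,
      toL2T_injective he]
  have hset : stationarySolutions σ = {toL2T (rhoZero σ), toL2T (gibbsDensity σ 0 b),
      toL2T (gibbsDensity σ 0 (-b))} := by
    rw [rhoZero_eq_gibbsDensity]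
    ext ρ
    simp only [Set.mem_insert_iff, Set.mem_singleton_iff]
    constructor
    · intro hρ
      obtain ⟨s, hs, rfl⟩ := (mem_stationarySolutions_iff_selfMap hσ ρ).mp hρ
      rcases lt_trichotomy s 0 with h1 | h1 | h1
      · have h2 : -s = t := selfMap_root_unique hσ (neg_pos.mpr h1) ht
          (by rw [selfMap_neg, hs, neg_zero]) hroot
        right; right
        rw [hb, ← h2, mul_neg, neg_neg]
      · left; rw [h1, mul_zero]
      · right; left
        rw [selfMap_root_unique hσ h1 ht hs hroot]
    · rintro (rfl | rfl | rfl)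
      · exact toL2T_gibbsDensity_mem hσ hsc0
      · exact toL2T_gibbsDensity_mem hσ hsc
      · exact toL2T_gibbsDensity_mem hσ hscn
  refine ⟨?_, gibbsDensity σ 0 b, gibbsDensity σ 0 (-b), smoothT_gibbsDensity _ _ _,
    smoothT_gibbsDensity _ _ _, centredAt_gibbsDensity hσ hb0 hsc, ?_, hset⟩
  · rw [hset, Set.encard_eq_three]
    refine ⟨_, _, _, fun he => ?_, fun he => ?_, fun he => ?_, rfl⟩
    · rw [rhoZero_eq_gibbsDensity] at he
      have := hinj hsc0 hsc he; linarith
    · rw [rhoZero_eq_gibbsDensity] at he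
      have := hinj hsc0 hscn he; linarith
    · have := hinj hsc hscn he; linarith
  · rw [AddCircle.coe_neg]
    have hfun : (gibbsDensity σ 0 (-b) : Torus → ℝ) = fun x => gibbsDensity σ 0 b (-x) :=
      funext fun x => (gibbsDensity_neg σ b x).symm
    rw [hfun]
    exact (centredAt_gibbsDensity hσ hb0 hsc).comp_neg

end

theorem mainTheorem1 :
    (∀ σ : ℝ, 0 < σ → toL2T (rhoZero σ) ∈ stationarySolutions σ) ∧
    ∃ σc : ℝ, 0 < σc ∧
      (fCrit σc = 0 ∧ ∀ σ : ℝ, 0 < σ → fCrit σ = 0 → σ = σc) ∧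
      |σc - 0.7709| ≤ 0.00005 ∧
      (∀ σ : ℝ, σc < σ → stationarySolutions σ = {toL2T (rhoZero σ)}) ∧
      (∃ σ₀ : ℝ, 0 < σ₀ ∧ ∀ σ : ℝ, 0 < σ → σ < σ₀ → ThreeStationarySolutions σ) ∧
      (∀ σ : ℝ, 1 / 2 ≤ σ → σ < σc → ThreeStationarySolutions σ) := by
  refine ⟨fun σ hσ => rhoZero_mem hσ, ?_⟩
  obtain ⟨σc, hl, hu, hroot⟩ := exists_momentRatio_eq
  have hσc : 0 < σc := by linarith
  -- The conclusion holds on all of `(0, σc)`, so `σc` itself serves as `σ₀` and the range from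
  -- `1/2` is a special case.
  have hthree : ∀ σ : ℝ, 0 < σ → σ < σc → ThreeStationarySolutions σ := by
    intro σ hσ hlt
    refine threeStationarySolutions hσ (hlt.trans_le ?_)
    rw [← hroot]
    exact momentRatio_anti hσ hlt.le
  refine ⟨σc, hσc, ⟨(fCrit_eq_zero_iff hσc).mpr hroot, fun σ hσ h =>
    momentRatio_root_unique hσ hσc ((fCrit_eq_zero_iff hσ).mp h) hroot⟩, ?_, fun σ hσ => ?_,
    ⟨σc, hσc, hthree⟩, fun σ hσ => hthree σ (by linarith)⟩
  · rw [abs_le]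
    constructor <;> linarith
  · refine stationarySolutions_eq_singleton (hσc.trans hσ) (le_trans ?_ hσ.le)
    rw [← hroot]
    exact momentRatio_anti hσc hσ.le
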